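/- Let $n\ge 2$ and let $Q\in SU_n$ be a special unitary $n\times n$ matrix with eigenvalues $\mu_1,\dots,\mu_n$ (repeated according to multiplicity). Let $s(Q)\ge 0$ be the multiplicity of $-1$ as an eigenvalue of $Q$ (with $s(Q)=0$ if $-1$ is not an eigenvalue), and let $\zeta(Q)=\frac{1}{2\pi}\sum_{j=1}^n\arg(\mu_j)$, where $\arg(\mu)\in(-\pi,\pi]$ is the principal argument. Let $\mathfrak{su}_n$ be the real vector space of skew-hermitian $n\times n$ complex matrices of trace zero, and let $\mathfrak{su}_n\text{-}plog(Q)$ be the set of generalized principal $\mathfrak{su}_n$-logarithms of $Q$, i.e. of those $X\in\mathfrak{su}_n$ such that $\exp(X)=Q$ and $-\pi\le\operatorname{Im}(\lambda)\le\pi$ for every eigenvalue $\lambda$ of $X$. Then: a) if $\zeta(Q)<0$ or $\zeta(Q)>s(Q)$, the set $\mathfrak{su}_n\text{-}plog(Q)$ is empty; b) if $0\le\zeta(Q)\le s(Q)$, then $\zeta(Q)$ is an integer and the set $\mathfrak{su}_n\text{-}plog(Q)$ is a compact (embedded, smooth) submanifold of $\mathfrak{su}_n$ diffeomorphic to the complex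 Grassmannian $\mathbf{Gr}(\zeta(Q);\mathbb{C}^{s(Q)})$ of $\zeta(Q)$-dimensional complex vector subspaces of $\mathbb{C}^{s(Q)}$; moreover, in this case $\mathfrak{su}_n\text{-}plog(Q)$ is a single point if and only if $\zeta(Q)=0$ or $\zeta(Q)=s(Q)$. -/

import Mathlib

open scoped Manifold ContDiff Matrix.Norms.Frobenius

noncomputable section

/-! ### The Lie algebra `su n`, generalized principal logarithms and eigenvalue data -/

/-- The real vector space of skew-hermitian `n × n` complex matrices of trace zero. As a subspace
of the space of all matrices it carries the Frobenius norm, whose topology is the usual one. -/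
def su (n : ℕ) : Submodule ℝ (Matrix (Fin n) (Fin n) ℂ) where
  carrier := {X | X.conjTranspose = -X ∧ X.trace = 0}
  add_mem' := by
    rintro X Y ⟨hX, hX'⟩ ⟨hY, hY'⟩
    refine ⟨?_, ?_⟩
    · rw [Matrix.conjTranspose_add, hX, hY, neg_add]
    · rw [Matrix.trace_add, hX', hY', add_zero]
  zero_mem' := by simp
  smul_mem' := by
    rintro c X ⟨hX, hX'⟩
    refine ⟨?_, ?_⟩
    · rw [Matrix.conjTranspose_smul, hX, star_trivial, smul_neg]
    · rw [Matrix.trace_smul, hX', smul_zero]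

/-- The set of generalized principal `𝔤`-logarithms of a matrix `B`: the elements `X` of the
(real) space of matrices `𝔤` with `exp X = B`, all of whose eigenvalues have imaginary part
in `[-π, π]`. -/
def plog {n : ℕ} (𝔤 : Submodule ℝ (Matrix (Fin n) (Fin n) ℂ)) (B : Matrix (Fin n) (Fin n) ℂ) :
    Set 𝔤 :=
  {X | NormedSpace.exp (X : Matrix (Fin n) (Fin n) ℂ) = B ∧
    ∀ z : ℂ, Module.End.HasEigenvalue (Matrix.toLin' (X : Matrix (Fin n) (Fin n) ℂ)) z →
      -Real.pi ≤ z.im ∧ z.im ≤ Real.pi}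

/-- The multiplicity of `-1` as an eigenvalue of `Q` (zero if `-1` is not an eigenvalue). -/
def negOneMult {n : ℕ} (Q : Matrix (Fin n) (Fin n) ℂ) : ℕ :=
  Q.charpoly.rootMultiplicity (-1)

/-- `(1 / 2π) ∑ arg μ`, the sum being over the eigenvalues `μ` of `Q`, repeated according to
their multiplicity, with `arg μ ∈ (-π, π]`. -/
def argSum {n : ℕ} (Q : Matrix (Fin n) (Fin n) ℂ) : ℝ :=
  1 / (2 * Real.pi) * (Q.charpoly.roots.map Complex.arg).sum

/-! ### The complex Grassmannian as a smooth manifold -/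

/-- `Gr k s` is the Grassmannian of `k`-dimensional complex vector subspaces of `ℂ^s`. -/
def Gr (k s : ℕ) : Type :=
  {W : Submodule ℂ (Fin s → ℂ) // Module.finrank ℂ W = k}

namespace Gr

variable {k s : ℕ}

/-- The model space of the Grassmannian: linear maps `ℂ^k → ℂ^(s-k)`. -/
abbrev Model (k s : ℕ) : Type := (Fin k → ℂ) →L[ℂ] (Fin (s - k) → ℂ)

/-- A linear splitting of `ℂ^s` into a `k`-dimensional and an `(s-k)`-dimensional space. -/
abbrev Frame (k s : ℕ) : Type :=
  ((Fin k → ℂ) × (Fin (s - k) → ℂ)) ≃L[ℂ] (Fin s → ℂ)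

/-- The injective linear map `x ↦ (x, T x)`, read in `ℂ^s` through the splitting `e`. -/
def graphMap (e : Frame k s) (T : Model k s) : (Fin k → ℂ) →ₗ[ℂ] (Fin s → ℂ) :=
  e.toLinearMap ∘ₗ LinearMap.prod LinearMap.id T.toLinearMap

theorem graphMap_apply (e : Frame k s) (T : Model k s) (x : Fin k → ℂ) :
    graphMap e T x = e (x, T x) := rfl

theorem graphMap_injective (e : Frame k s) (T : Model k s) :
    Function.Injective (graphMap e T) := by
  intro x y h
  rw [graphMap_apply, graphMap_apply] at h
  exact congrArg Prod.fst (e.injective h)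

/-- The inverse chart of the splitting `e`: a linear map is sent to its graph. -/
def param (e : Frame k s) (T : Model k s) : Gr k s :=
  ⟨LinearMap.range (graphMap e T), by
    rw [LinearMap.finrank_range_of_inj (graphMap_injective e T)]; simp⟩

theorem mem_param {e : Frame k s} {T : Model k s} {v : Fin s → ℂ} :
    v ∈ (param e T).1 ↔ ∃ x, e (x, T x) = v := Iff.rfl

/-- The `ℂ^k`-component of the change of splitting from `e` to `e'`, along the graph of `T`. -/
def denom (e e' : Frame k s) (T : Model k s) : (Fin k → ℂ) →L[ℂ] (Fin k → ℂ) :=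
  (ContinuousLinearMap.fst ℂ _ _ ∘L (e'.symm.toContinuousLinearMap ∘L
    e.toContinuousLinearMap)) ∘L ((ContinuousLinearMap.id ℂ _).prod T)

/-- The `ℂ^(s-k)`-component of the change of splitting from `e` to `e'`, along the graph
of `T`. -/
def numer (e e' : Frame k s) (T : Model k s) : Model k s :=
  (ContinuousLinearMap.snd ℂ _ _ ∘L (e'.symm.toContinuousLinearMap ∘L
    e.toContinuousLinearMap)) ∘L ((ContinuousLinearMap.id ℂ _).prod T)

theorem denom_apply (e e' : Frame k s) (T : Model k s) (x : Fin k → ℂ) :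
    denom e e' T x = (e'.symm (e (x, T x))).1 := rfl

theorem numer_apply (e e' : Frame k s) (T : Model k s) (x : Fin k → ℂ) :
    numer e e' T x = (e'.symm (e (x, T x))).2 := rfl

theorem isUnit_denom {e e' : Frame k s} {T T' : Model k s} (h : param e T = param e' T') :
    IsUnit (denom e e' T) ∧ T' ∘L denom e e' T = numer e e' T := by
  have key : ∀ x, (e'.symm (e (x, T x))).2 = T' (e'.symm (e (x, T x))).1 := by
    intro x
    have hx : e (x, T x) ∈ (param e' T').1 := by
      rw [← h]; exact mem_param.2 ⟨x, rfl⟩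
    obtain ⟨y, hy⟩ := mem_param.1 hx
    rw [← hy]; simp
  have inj : Function.Injective (denom e e' T) := by
    intro x y hxy
    rw [denom_apply, denom_apply] at hxy
    have h2 : e'.symm (e (x, T x)) = e'.symm (e (y, T y)) := by
      refine Prod.ext hxy ?_
      rw [key, key, hxy]
    exact congrArg Prod.fst (e.injective (e'.symm.injective h2))
  refine ⟨?_, ?_⟩
  · have hbij : Function.Bijective (denom e e' T) :=
      ⟨inj, LinearMap.surjective_of_injective (f := (denom e e' T).toLinearMap) inj⟩
    let u : (Fin k → ℂ) ≃L[ℂ] (Fin k → ℂ) :=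
      (LinearEquiv.ofBijective (denom e e' T).toLinearMap hbij).toContinuousLinearEquiv
    have hu : (u : (Fin k → ℂ) →L[ℂ] (Fin k → ℂ)) = denom e e' T := by
      ext1 x; rfl
    rw [← hu]
    exact (ContinuousLinearEquiv.unitsEquiv ℂ _).symm u |>.isUnit
  · ext1 x
    exact (key x).symm

theorem param_eq_of_isUnit {e e' : Frame k s} {T : Model k s} (h : IsUnit (denom e e' T)) :
    param e T = param e' (numer e e' T ∘L Ring.inverse (denom e e' T)) := by
  have h1 : ∀ x, Ring.inverse (denom e e' T) (denom e e' T x) = x := fun x =>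
    DFunLike.congr_fun (Ring.inverse_mul_cancel _ h) x
  have h2 : ∀ x, denom e e' T (Ring.inverse (denom e e' T) x) = x := fun x =>
    DFunLike.congr_fun (Ring.mul_inverse_cancel _ h) x
  have pt : ∀ x, e' (denom e e' T x, numer e e' T x) = e (x, T x) := fun x => by
    rw [denom_apply, numer_apply, Prod.mk.eta, ContinuousLinearEquiv.apply_symm_apply]
  apply Subtype.ext
  ext v
  rw [mem_param, mem_param]
  constructor
  · rintro ⟨x, rfl⟩
    refine ⟨denom e e' T x, ?_⟩
    rw [ContinuousLinearMap.comp_apply, h1, pt]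
  · rintro ⟨y, rfl⟩
    refine ⟨Ring.inverse (denom e e' T) y, ?_⟩
    rw [← pt, h2, ContinuousLinearMap.comp_apply]

theorem param_injective (e : Frame k s) : Function.Injective (param e) := by
  intro T T' h
  have hd : denom e e T = ContinuousLinearMap.id ℂ _ := by
    ext1 x; rw [denom_apply]; simp
  have hn : numer e e T = T := by
    ext1 x; rw [numer_apply]; simp
  have := (isUnit_denom h).2
  rw [hd, hn, ContinuousLinearMap.comp_id] at this
  exact this.symm

/-- The graph chart of the splitting `e`, defined on the subspaces that are graphs. -/
def chart (e : Frame k s) : PartialEquiv (Gr k s) (Model k s) :=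
  ((param_injective e).injOn.toPartialEquiv (param e) Set.univ).symm

theorem chart_source (e : Frame k s) : (chart e).source = Set.range (param e) :=
  Set.image_univ

theorem chart_symm_apply (e : Frame k s) (T : Model k s) : (chart e).symm T = param e T := rfl

theorem chart_param (e : Frame k s) (T : Model k s) : chart e (param e T) = T :=
  (chart e).right_inv (x := T) (Set.mem_univ T)

theorem transition_source (e e' : Frame k s) :
    ((chart e).symm.trans (chart e')).source = {T | IsUnit (denom e e' T)} := by
  ext T
  rw [PartialEquiv.trans_source, Set.mem_inter_iff, Set.mem_preimage, chart_source,
    chart_symm_apply, Set.mem_ofPred_eq]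
  constructor
  · rintro ⟨-, T', hT'⟩
    exact (isUnit_denom hT'.symm).1
  · intro h
    exact ⟨Set.mem_univ T, _, (param_eq_of_isUnit h).symm⟩

theorem transition_apply {e e' : Frame k s} {T : Model k s} (h : IsUnit (denom e e' T)) :
    (chart e).symm.trans (chart e') T = numer e e' T ∘L Ring.inverse (denom e e' T) := by
  rw [PartialEquiv.coe_trans, Function.comp_apply, chart_symm_apply, param_eq_of_isUnit h,
    chart_param]

theorem contDiff_graph : ContDiff ℂ ∞
    (fun T : Model k s => (ContinuousLinearMap.id ℂ (Fin k → ℂ)).prod T) := by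
  have h : (fun T : Model k s => (ContinuousLinearMap.id ℂ (Fin k → ℂ)).prod T) =
      fun T => ContinuousLinearMap.inl ℂ _ _ + ContinuousLinearMap.inr ℂ _ _ ∘L T := by
    funext T
    ext1 x
    simp
  rw [h]
  exact contDiff_const.add (contDiff_const.clm_comp contDiff_id)

theorem contDiff_denom (e e' : Frame k s) : ContDiff ℂ ∞ (denom e e') :=
  contDiff_const.clm_comp contDiff_graph

theorem contDiff_numer (e e' : Frame k s) : ContDiff ℂ ∞ (numer e e') :=
  contDiff_const.clm_comp contDiff_graph

theorem contDiffOn_transition (e e' : Frame k s) :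
    ContDiffOn ℂ ∞ ((chart e).symm.trans (chart e'))
      ((chart e).symm.trans (chart e')).source := by
  rw [transition_source]
  refine ContDiffOn.congr (f := fun T => numer e e' T ∘L Ring.inverse (denom e e' T)) ?_
    (fun T hT => transition_apply hT)
  intro T hT
  refine ContDiffAt.contDiffWithinAt ?_
  obtain ⟨u, hu⟩ := hT
  have hinv : ContDiffAt ℂ ∞ (fun T => Ring.inverse (denom e e' T)) T :=
    ContDiffAt.fun_comp T (by rw [← hu]; exact contDiffAt_ringInverse ℂ u)
      (contDiff_denom e e').contDiffAt
  exact (contDiff_numer e e').contDiffAt.clm_comp hinv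

theorem isOpen_transition_source (e e' : Frame k s) :
    IsOpen ((chart e).symm.trans (chart e')).source := by
  rw [transition_source]
  exact Units.isOpen.preimage (contDiff_denom e e').continuous

theorem exists_frame (W : Gr k s) : ∃ e : Frame k s, W ∈ (chart e).source := by
  obtain ⟨W, hW⟩ := W
  obtain ⟨W', hc⟩ := Submodule.exists_isCompl W
  have hsum := Submodule.finrank_add_eq_of_isCompl hc
  have hW' : Module.finrank ℂ W' = s - k := by
    rw [Module.finrank_fin_fun, hW] at hsum; omega
  let a : (Fin k → ℂ) ≃ₗ[ℂ] W := LinearEquiv.ofFinrankEq _ _ (by rw [hW]; simp)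
  let b : (Fin (s - k) → ℂ) ≃ₗ[ℂ] W' := LinearEquiv.ofFinrankEq _ _ (by rw [hW']; simp)
  let e : Frame k s :=
    ((a.prodCongr b).trans (Submodule.prodEquivOfIsCompl W W' hc)).toContinuousLinearEquiv
  have he : ∀ x y, e (x, y) = (a x : Fin s → ℂ) + (b y : Fin s → ℂ) := fun x y => rfl
  refine ⟨e, ?_⟩
  rw [chart_source]
  refine ⟨0, Subtype.ext ?_⟩
  ext v
  rw [mem_param]
  constructor
  · rintro ⟨x, rfl⟩
    rw [he]
    simp
  · intro hv
    refine ⟨a.symm ⟨v, hv⟩, ?_⟩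
    rw [he]
    simp

/-- The graph charts of all splittings form an atlas; the topology is the one for which all of
them are homeomorphisms onto open sets. -/
def core (k s : ℕ) : ChartedSpaceCore (Model k s) (Gr k s) where
  atlas := Set.range chart
  chartAt W := chart (exists_frame W).choose
  mem_chart_source W := (exists_frame W).choose_spec
  chart_mem_atlas W := ⟨_, rfl⟩
  open_source := by
    rintro _ _ ⟨e, rfl⟩ ⟨e', rfl⟩
    exact isOpen_transition_source e e'
  continuousOn_toFun := by
    rintro _ _ ⟨e, rfl⟩ ⟨e', rfl⟩
    exact (contDiffOn_transition e e').continuousOn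

instance : TopologicalSpace (Gr k s) := (core k s).toTopologicalSpace

instance : ChartedSpace (Model k s) (Gr k s) := (core k s).toChartedSpace

/-- The Grassmannian is a smooth real manifold. -/
instance : IsManifold 𝓘(ℝ, Model k s) ∞ (Gr k s) := by
  refine isManifold_of_contDiffOn _ _ _ ?_
  intro f f' hf hf'
  obtain ⟨_, ⟨c, rfl⟩, hf⟩ := Set.mem_iUnion.1 hf |>.imp fun _ h => Set.mem_iUnion.1 h
  obtain ⟨_, ⟨c', rfl⟩, hf'⟩ := Set.mem_iUnion.1 hf' |>.imp fun _ h => Set.mem_iUnion.1 h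
  rw [Set.mem_singleton_iff] at hf hf'
  subst hf hf'
  have h := (contDiffOn_transition c c').restrict_scalars ℝ
  simp only [modelWithCornersSelf_coe, modelWithCornersSelf_coe_symm, Set.range_id,
    Set.inter_univ, Set.preimage_id, Function.id_comp, Function.comp_id]
  exact h

end Gr

/-! ### Submanifolds -/

/-- The subset `S` of the normed space `V` is an embedded smooth submanifold of `V`, and as such
it is diffeomorphic to the manifold `N`: the topological subspace `S` has an atlas modelled on
some `ℝ^d` which makes it a smooth manifold whose inclusion in `V` is a smooth embedding, and
there is a smooth diffeomorphism from `S` with this atlas onto `N`. -/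
def IsSubmanifoldDiffeomorphicTo {V : Type} [NormedAddCommGroup V] [NormedSpace ℝ V] (S : Set V)
    {E H : Type} [NormedAddCommGroup E] [NormedSpace ℝ E] [TopologicalSpace H]
    (J : ModelWithCorners ℝ E H) (N : Type) [TopologicalSpace N] [ChartedSpace H N] : Prop :=
  ∃ (d : ℕ) (_ : ChartedSpace (EuclideanSpace ℝ (Fin d)) S),
    IsManifold (𝓡 d) ∞ S ∧
    Manifold.IsSmoothEmbedding (𝓡 d) 𝓘(ℝ, V) ∞ (Subtype.val : S → V) ∧
    Nonempty (Diffeomorph (𝓡 d) J S N ∞)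

end

/-! Write `Q = U diag(d) U*` with `U` unitary, let `s` be the multiplicity of `-1`, `ζ = argSum Q`,
and let `L = U diag(i arg d) U*` be the principal logarithm, whose trace is `2πiζ`. A generalized
principal logarithm `X` is skew-hermitian, so it is unitarily diagonalisable with eigenvalues `iθ`,
`θ ∈ [-π, π]`, and its eigenbasis also diagonalises `Q = exp X`. There `θ = arg (exp (iθ))` unless
`θ = -π`, when the argument is `π`. Hence `X = L - 2πi R`, where `R` is the orthogonal projector
onto the `-πi`-eigenspace of `X`, a subspace of the `-1`-eigenspace of `Q`. With an isometry `J` of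
`ℂ^s` onto that eigenspace, `R = J P J*`, and `tr X = 0` means `tr P = ζ`. Conversely every such `P`
gives a logarithm (`PrincipalLog.mem_plog_iff`).

The trace of a projector is its rank, so logarithms exist only for `0 ≤ ζ ≤ s`; `det Q = 1` makes
`ζ` an integer (`exists_int_eq_argSum`). Projectors of fixed rank form a compact set, with a single
element exactly when the rank is `0` or `s` (`subsingleton_isStarProjection_iff`).

The map `P ↦ L - 2πi J P J*` is affine with an affine left inverse, so the geometry reduces to the
map sending a subspace to its orthogonal projector. That map is smooth in graph charts and has local
smooth left inverses, which makes it an embedding by the inverse function theorem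
(`isSmoothEmbedding_of_left_inverse`, `Gr.isSubmanifoldDiffeomorphicTo_range_proj`). -/

/-! ### Immersions, and images of smooth maps with smooth local retractions -/

/-- A smooth self-map of a finite-dimensional space with invertible derivative at a point restricts
to a smooth chart near that point, in the inverse direction. -/
theorem exists_chart_symm_eq_of_hasFDerivAt {V : Type*} [NormedAddCommGroup V] [NormedSpace ℝ V]
    [FiniteDimensional ℝ V] {Ψ : V → V} {D : Set V} (hD : IsOpen D) (hΨ : ContDiffOn ℝ ∞ Ψ D)
    {a : V} (ha : a ∈ D) (L : V ≃L[ℝ] V) (hL : HasFDerivAt Ψ (L : V →L[ℝ] V) a) :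
    ∃ q : OpenPartialHomeomorph V V, q ∈ IsManifold.maximalAtlas 𝓘(ℝ, V) ∞ V ∧
      a ∈ q.target ∧ ⇑q.symm = Ψ := by
  have : CompleteSpace V := FiniteDimensional.complete ℝ V
  have hca : ContDiffAt ℝ ∞ Ψ a := hΨ.contDiffAt (hD.mem_nhds ha)
  have h0 : (∞ : ℕ∞ω) ≠ 0 := by simp
  let p := hca.toOpenPartialHomeomorph Ψ hL h0
  have hp : ⇑p = Ψ := rfl
  have hap : a ∈ p.source := hca.mem_toOpenPartialHomeomorph_source hL h0
  -- A chart of the maximal atlas needs a smooth inverse on its whole domain, so the domain is cut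
  -- down to where the derivative stays invertible.
  let G : Set V := D ∩ fderiv ℝ Ψ ⁻¹' Set.range ((↑) : (V ≃L[ℝ] V) → V →L[ℝ] V)
  have hG : IsOpen G :=
    (hΨ.continuousOn_fderiv_of_isOpen hD (by simp)).isOpen_inter_preimage hD
      ContinuousLinearEquiv.isOpen
  have haG : a ∈ G := ⟨ha, L, hL.fderiv.symm⟩
  let q := p.restrOpen G hG
  have hqs : q.source ⊆ G := fun x hx => by
    rw [p.restrOpen_source] at hx; exact hx.2
  have hq : ⇑q = Ψ := hp
  refine ⟨q.symm, ?_, ?_, ?_⟩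
  · refine q.symm.mem_maximalAtlas_of_contMDiffOn (I := 𝓘(ℝ, V)) ?_ ?_
    · rw [contMDiffOn_iff_contDiffOn]
      intro y hy
      refine ContDiffAt.contDiffWithinAt ?_
      have hx : q.symm y ∈ G := hqs (q.map_target hy)
      obtain ⟨-, L', hL'⟩ := id hx
      have hcx : ContDiffAt ℝ ∞ Ψ (q.symm y) := hΨ.contDiffAt (hD.mem_nhds hx.1)
      refine q.contDiffAt_symm (f₀' := L') hy ?_ hcx
      rw [hL']
      exact (hcx.differentiableAt h0).hasFDerivAt
    · rw [contMDiffOn_iff_contDiffOn]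
      exact hΨ.mono fun x hx => (hqs hx).1
  · change a ∈ q.source
    rw [p.restrOpen_source]
    exact ⟨hap, haG⟩
  · exact hq

section

variable {E V F M : Type*} [NormedAddCommGroup E] [NormedSpace ℝ E] [FiniteDimensional ℝ E]
  [NormedAddCommGroup V] [NormedSpace ℝ V] [FiniteDimensional ℝ V]
  [NormedAddCommGroup F] [NormedSpace ℝ F] [FiniteDimensional ℝ F]
  [TopologicalSpace M] [ChartedSpace E M] [IsManifold 𝓘(ℝ, E) ∞ M]

/-- An injective linear map extends to an isomorphism from the product with a space of
complementary dimension. -/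
theorem exists_equiv_prod_of_injective (A : E →L[ℝ] V) (hA : Function.Injective A)
    (hF : Module.finrank ℝ F = Module.finrank ℝ V - Module.finrank ℝ E) :
    ∃ L : (E × F) ≃L[ℝ] V, ∀ u, L (u, 0) = A u := by
  obtain ⟨C, hC⟩ := Submodule.exists_isCompl (LinearMap.range (A : E →ₗ[ℝ] V))
  have h1 := Submodule.finrank_add_eq_of_isCompl hC
  rw [LinearMap.finrank_range_of_inj (f := (A : E →ₗ[ℝ] V)) hA] at h1
  let b : F ≃ₗ[ℝ] C := LinearEquiv.ofFinrankEq _ _ (by omega)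
  let a : E ≃ₗ[ℝ] LinearMap.range (A : E →ₗ[ℝ] V) := LinearEquiv.ofInjective _ hA
  refine ⟨((a.prodCongr b).trans
    (Submodule.prodEquivOfIsCompl _ _ hC)).toContinuousLinearEquiv, fun u => ?_⟩
  change ((a u : V) + (b 0 : V)) = A u
  simp [a]

/-- A smooth map with a smooth left inverse near the image of a point is an immersion there. -/
theorem isImmersionAtOfComplement_of_left_inverse
    (hF : Module.finrank ℝ F = Module.finrank ℝ V - Module.finrank ℝ E)
    {f : M → V} {g : V → M} {x : M} (hf : ContMDiff 𝓘(ℝ, E) 𝓘(ℝ, V) ∞ f)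
    (hg : ContMDiffAt 𝓘(ℝ, V) 𝓘(ℝ, E) ∞ g (f x)) (hgf : ∀ᶠ y in nhds x, g (f y) = y) :
    Manifold.IsImmersionAtOfComplement F 𝓘(ℝ, E) 𝓘(ℝ, V) ∞ f x := by
  have h0 : (∞ : ℕ∞ω) ≠ 0 := by simp
  set c := chartAt E x with hc
  have hxc : x ∈ c.source := mem_chart_source E x
  have hcx : c x ∈ c.target := c.map_source hxc
  have hsymm : c.symm (c x) = x := c.left_inv hxc
  have hgx : g (f x) = x := hgf.self_of_nhds
  have hf' : ContDiffOn ℝ ∞ (f ∘ c.symm) c.target := by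
    rw [← contMDiffOn_iff_contDiffOn]
    exact hf.comp_contMDiffOn contMDiffOn_chart_symm
  have hfa : ContDiffAt ℝ ∞ (f ∘ c.symm) (c x) := hf'.contDiffAt (c.open_target.mem_nhds hcx)
  have hg' : ContDiffAt ℝ ∞ (c ∘ g) (f x) := by
    rw [← contMDiffAt_iff_contDiffAt]
    refine ContMDiffAt.comp (I' := 𝓘(ℝ, E)) _ ?_ hg
    rw [hgx]
    exact contMDiffOn_chart.contMDiffAt (c.open_source.mem_nhds hxc)
  set A := fderiv ℝ (f ∘ c.symm) (c x) with hA
  have hfA : HasFDerivAt (f ∘ c.symm) A (c x) := (hfa.differentiableAt h0).hasFDerivAt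
  have hcomp : HasFDerivAt ((c ∘ g) ∘ (f ∘ c.symm)) (fderiv ℝ (c ∘ g) (f x) ∘L A) (c x) := by
    refine HasFDerivAt.comp _ ?_ hfA
    rw [Function.comp_apply, hsymm]
    exact (hg'.differentiableAt h0).hasFDerivAt
  have hid : (c ∘ g) ∘ (f ∘ c.symm) =ᶠ[nhds (c x)] id := by
    have h1 : Filter.Tendsto c.symm (nhds (c x)) (nhds x) := by
      have := c.continuousAt_symm hcx
      rwa [ContinuousAt, hsymm] at this
    filter_upwards [h1.eventually hgf, c.open_target.mem_nhds hcx] with u hu hut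
    simp only [Function.comp_apply, hu, id]
    exact c.right_inv hut
  -- Differentiating `g ∘ f = id` in the chart gives a left inverse of `A`, whence `A` is injective.
  have hleft : fderiv ℝ (c ∘ g) (f x) ∘L A = ContinuousLinearMap.id ℝ E :=
    (hcomp.congr_of_eventuallyEq hid.symm).unique (hasFDerivAt_id _)
  have hinj : Function.Injective A := fun u v huv => by
    have := congrArg (fderiv ℝ (c ∘ g) (f x)) huv
    have e := fun w => DFunLike.congr_fun hleft w
    simp only [ContinuousLinearMap.comp_apply, ContinuousLinearMap.id_apply] at e
    rwa [e, e] at this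
  obtain ⟨L, hL⟩ := exists_equiv_prod_of_injective (F := F) A hinj hF
  -- near `(c x, 0)`, the map `(u, w) ↦ f (c⁻¹ u) + L (0, w)` is a diffeomorphism
  let Ψ : V → V := fun v => (f ∘ c.symm) (L.symm v).1 + L (0, (L.symm v).2)
  let D : Set V := (fun v => (L.symm v).1) ⁻¹' c.target
  have hDc : Continuous fun v => (L.symm v).1 := by fun_prop
  have hfst : ContDiff ℝ ∞ fun v => (L.symm v).1 := contDiff_fst.comp L.symm.contDiff
  have hsnd : ContDiff ℝ ∞ fun v => (L.symm v).2 := contDiff_snd.comp L.symm.contDiff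
  have hΨ : ContDiffOn ℝ ∞ Ψ D := by
    refine ContDiffOn.add (hf'.comp hfst.contDiffOn fun v hv => hv) ?_
    exact (L.contDiff.comp (contDiff_const.prodMk hsnd)).contDiffOn
  have haD : L (c x, 0) ∈ D := by simpa [D] using hcx
  -- The derivative sends `L (u, w)` to `A u + L (0, w)`, which is `L (u, w)` because `L` extends
  -- `A`.
  have hΨd : HasFDerivAt Ψ ((ContinuousLinearEquiv.refl ℝ V : V ≃L[ℝ] V) : V →L[ℝ] V)
      (L (c x, 0)) := by
    have h1 : HasFDerivAt (fun v => (f ∘ c.symm) (L.symm v).1)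
        (A ∘L (ContinuousLinearMap.fst ℝ E F ∘L (L.symm : V →L[ℝ] E × F))) (L (c x, 0)) := by
      refine HasFDerivAt.comp (g := f ∘ c.symm) (f := fun v => (L.symm v).1) _ ?_ ?_
      · simpa using hfA
      · exact ContinuousLinearMap.hasFDerivAt
          (ContinuousLinearMap.fst ℝ E F ∘L (L.symm : V →L[ℝ] E × F))
    have h2 : HasFDerivAt (fun v => L (0, (L.symm v).2))
        ((L : E × F →L[ℝ] V) ∘L (ContinuousLinearMap.inr ℝ E F ∘L
          (ContinuousLinearMap.snd ℝ E F ∘L (L.symm : V →L[ℝ] E × F)))) (L (c x, 0)) :=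
      ContinuousLinearMap.hasFDerivAt ((L : E × F →L[ℝ] V) ∘L (ContinuousLinearMap.inr ℝ E F ∘L
          (ContinuousLinearMap.snd ℝ E F ∘L (L.symm : V →L[ℝ] E × F))))
    refine (h1.add h2).congr_fderiv ?_
    ext v
    simp [← hL, ← map_add]
  obtain ⟨q, hq, haq, hqΨ⟩ := exists_chart_symm_eq_of_hasFDerivAt (D := D)
    (c.open_target.preimage hDc) hΨ haD _ hΨd
  have hval : ∀ u, Ψ (L (u, 0)) = f (c.symm u) := fun u => by
    simp only [Ψ, L.symm_apply_apply, Prod.mk_zero_zero, map_zero, add_zero, Function.comp_apply]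
  have hfx : f x ∈ q.source := by
    have h := q.map_target haq
    rwa [hqΨ, hval, hsymm] at h
  -- shrink the chart of `M` so that its image lies in the domain of `q`
  let O : Set M := c.source ∩ c ⁻¹' ((fun u : E => L (u, (0 : F))) ⁻¹' q.target)
  have hO : IsOpen O := c.isOpen_inter_preimage
    (q.open_target.preimage (by fun_prop))
  have hxO : x ∈ O := ⟨hxc, haq⟩
  have hcO : c.restr O ∈ IsManifold.maximalAtlas 𝓘(ℝ, E) ∞ M :=
    restr_mem_maximalAtlas _ (IsManifold.chart_mem_maximalAtlas x) hO
  refine Manifold.IsImmersionAtOfComplement.mk_of_continuousAt hf.continuous.continuousAt L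
    (c.restr O) q ?_ hfx hcO hq ?_
  · rw [c.restr_source' O hO]; exact ⟨hxc, hxO⟩
  · intro u hu
    have hu' : u ∈ c.target ∧ c.symm u ∈ O := by
      simpa [hO.interior_eq] using hu
    have hut : L (u, 0) ∈ q.target := by
      have := hu'.2.2
      rwa [Set.mem_preimage, Set.mem_preimage, c.right_inv hu'.1] at this
    have e : f (c.symm u) = q.symm (L (u, 0)) := by rw [hqΨ, hval]
    simp only [Function.comp_apply, OpenPartialHomeomorph.extend_coe, OpenPartialHomeomorph.extend_coe_symm,
      modelWithCornersSelf_coe, modelWithCornersSelf_coe_symm, id,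
      OpenPartialHomeomorph.restr_symm_apply]
    rw [e, q.right_inv hut]

/-- A smooth map with local smooth left inverses is a smooth embedding. -/
theorem isSmoothEmbedding_of_left_inverse {f : M → V} (hf : ContMDiff 𝓘(ℝ, E) 𝓘(ℝ, V) ∞ f)
    (hg : ∀ x, ∃ g : V → M, ContMDiffAt 𝓘(ℝ, V) 𝓘(ℝ, E) ∞ g (f x) ∧
      ∀ᶠ v in nhds (f x), ∀ y, f y = v → g v = y) :
    Manifold.IsSmoothEmbedding 𝓘(ℝ, E) 𝓘(ℝ, V) ∞ f := by
  refine ⟨Manifold.IsImmersionOfComplement.isImmersion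
    (F := EuclideanSpace ℝ (Fin (Module.finrank ℝ V - Module.finrank ℝ E))) fun x => ?_, ?_, ?_⟩
  · obtain ⟨g, hg, hgf⟩ := hg x
    refine isImmersionAtOfComplement_of_left_inverse (by simp) hf hg ?_
    filter_upwards [hf.continuous.continuousAt.eventually hgf] with y hy using hy y rfl
  -- The inducing property and injectivity use that `g` recovers every preimage of a point near `f
  -- x`, not only the preimages near `x`.
  · rw [Topology.isInducing_iff_nhds]
    refine fun x => le_antisymm hf.continuous.continuousAt.le_comap ?_
    obtain ⟨g, hg, hgf⟩ := hg x
    intro U hU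
    have hgx : g (f x) = x := hgf.self_of_nhds x rfl
    have hgU : ∀ᶠ v in nhds (f x), g v ∈ U := hg.continuousAt (by rwa [hgx])
    refine ⟨_, hgf.and hgU, fun y hy => ?_⟩
    have h1 : g (f y) = y := hy.1 y rfl
    have h2 : g (f y) ∈ U := hy.2
    rwa [h1] at h2
  · intro x y hxy
    obtain ⟨g, -, hgf⟩ := hg x
    rw [← hgf.self_of_nhds x rfl, hgf.self_of_nhds y hxy.symm]

end

/-! ### Transport of a smooth structure along a homeomorphism -/

section

variable {E E' S N : Type*} [NormedAddCommGroup E] [NormedSpace ℝ E]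
  [NormedAddCommGroup E'] [NormedSpace ℝ E'] [TopologicalSpace S]
  [TopologicalSpace N] [ChartedSpace E N]

/-- A chart transported along a homeomorphism, and along an isomorphism of the model spaces. -/
abbrev transportChart (h : S ≃ₜ N) (l : E ≃L[ℝ] E') (c : OpenPartialHomeomorph N E) :
    OpenPartialHomeomorph S E' :=
  (h.transOpenPartialHomeomorph c).transHomeomorph l.toHomeomorph

/-- The charted space structure transported along a homeomorphism, and along an isomorphism of the
model spaces. -/
abbrev transportChartedSpace (h : S ≃ₜ N) (l : E ≃L[ℝ] E') : ChartedSpace E' S where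
  atlas := transportChart h l '' atlas E N
  chartAt x := transportChart h l (chartAt E (h x))
  mem_chart_source x := mem_chart_source E (h x)
  chart_mem_atlas x := ⟨_, chart_mem_atlas E (h x), rfl⟩

/-- The homeomorphism cancels in every transition map, leaving a transition map of `N` conjugated by
the linear isomorphism `l`. -/
theorem isManifold_transport [IsManifold 𝓘(ℝ, E) ∞ N] (h : S ≃ₜ N) (l : E ≃L[ℝ] E') :
    letI := transportChartedSpace h l
    IsManifold 𝓘(ℝ, E') ∞ S := by
  let := transportChartedSpace h l
  refine isManifold_of_contDiffOn _ _ _ ?_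
  rintro _ _ ⟨c, hc, rfl⟩ ⟨c', hc', rfl⟩
  simp only [modelWithCornersSelf_coe, modelWithCornersSelf_coe_symm, Set.range_id,
    Set.inter_univ, Set.preimage_id, Function.id_comp, Function.comp_id]
  have hc1 := contMDiffOn_symm_of_mem_maximalAtlas
    (IsManifold.subset_maximalAtlas (I := 𝓘(ℝ, E)) (n := ∞) hc)
  have hc2 := contMDiffOn_of_mem_maximalAtlas
    (IsManifold.subset_maximalAtlas (I := 𝓘(ℝ, E)) (n := ∞) hc')
  have h1 : ContDiffOn ℝ ∞ (c' ∘ c.symm) (c.target ∩ c.symm ⁻¹' c'.source) := by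
    rw [← contMDiffOn_iff_contDiffOn]
    exact hc2.comp (hc1.mono Set.inter_subset_left) Set.inter_subset_right
  have h2 : ContDiffOn ℝ ∞ (l ∘ (c' ∘ c.symm) ∘ l.symm)
      (l.symm ⁻¹' (c.target ∩ c.symm ⁻¹' c'.source)) :=
    l.contDiff.comp_contDiffOn (h1.comp l.symm.contDiff.contDiffOn fun _ hx => hx)
  refine (h2.congr fun x hx => ?_).mono fun x hx => ?_
  · simp
  · simpa using hx

/-- A homeomorphism is a diffeomorphism for the transported structure. -/
def transportDiffeomorph [IsManifold 𝓘(ℝ, E) ∞ N] (h : S ≃ₜ N) (l : E ≃L[ℝ] E') :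
    letI := transportChartedSpace h l
    Diffeomorph 𝓘(ℝ, E') 𝓘(ℝ, E) S N ∞ :=
  letI := transportChartedSpace h l
  haveI := isManifold_transport h l
  { toEquiv := h.toEquiv
    contMDiff_toFun := fun x => by
      have hS : x ∈ (chartAt E' x).source := mem_chart_source E' x
      have h1 : ContMDiffOn 𝓘(ℝ, E') 𝓘(ℝ, E') ∞ (chartAt E' x) (chartAt E' x).source :=
        contMDiffOn_chart
      have h2 : ContMDiffOn 𝓘(ℝ, E) 𝓘(ℝ, E) ∞ (chartAt E (h x)).symm (chartAt E (h x)).target :=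
        contMDiffOn_chart_symm
      -- Read in a chart of `N` and its transport, `h` is just `l.symm`.
      have h3 : ContMDiffOn 𝓘(ℝ, E') 𝓘(ℝ, E) ∞
          ((chartAt E (h x)).symm ∘ l.symm ∘ chartAt E' x) (chartAt E' x).source :=
        h2.comp (l.symm.contDiff.contMDiff.comp_contMDiffOn h1) fun y hy => by
          change l.symm (l (chartAt E (h x) (h y))) ∈ (chartAt E (h x)).target
          rw [l.symm_apply_apply]
          exact (chartAt E (h x)).map_source hy
      refine (h3.congr fun y hy => ?_).contMDiffAt ((chartAt E' x).open_source.mem_nhds hS)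
      change h y = (chartAt E (h x)).symm (l.symm (l (chartAt E (h x) (h y))))
      rw [l.symm_apply_apply]
      exact ((chartAt E (h x)).left_inv hy).symm
    contMDiff_invFun := fun z => by
      have hz : z ∈ (chartAt E z).source := mem_chart_source E z
      have h1 : ContMDiffOn 𝓘(ℝ, E) 𝓘(ℝ, E) ∞ (chartAt E z) (chartAt E z).source :=
        contMDiffOn_chart
      have h2 : ContMDiffOn 𝓘(ℝ, E') 𝓘(ℝ, E') ∞ (transportChart h l (chartAt E z)).symm
          (transportChart h l (chartAt E z)).target :=
        contMDiffOn_symm_of_mem_maximalAtlas (IsManifold.subset_maximalAtlas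
          ⟨_, chart_mem_atlas E z, rfl⟩)
      have h3 : ContMDiffOn 𝓘(ℝ, E) 𝓘(ℝ, E') ∞
          ((transportChart h l (chartAt E z)).symm ∘ l ∘ chartAt E z) (chartAt E z).source :=
        h2.comp (l.contDiff.contMDiff.comp_contMDiffOn h1) fun y hy => by
          change l.symm (l (chartAt E z y)) ∈ (chartAt E z).target
          rw [l.symm_apply_apply]
          exact (chartAt E z).map_source hy
      refine (h3.congr fun y hy => ?_).contMDiffAt ((chartAt E z).open_source.mem_nhds hz)
      change h.symm y = h.symm ((chartAt E z).symm (l.symm (l (chartAt E z y))))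
      rw [l.symm_apply_apply, (chartAt E z).left_inv hy] }

end

/-- The image of a smooth map with local smooth left inverses is an embedded submanifold,
diffeomorphic to the source. -/
theorem isSubmanifoldDiffeomorphicTo_range {V E N : Type} [NormedAddCommGroup E]
    [NormedSpace ℝ E] [FiniteDimensional ℝ E] [NormedAddCommGroup V] [NormedSpace ℝ V]
    [FiniteDimensional ℝ V] [TopologicalSpace N] [ChartedSpace E N] [IsManifold 𝓘(ℝ, E) ∞ N]
    {f : N → V} (hf : ContMDiff 𝓘(ℝ, E) 𝓘(ℝ, V) ∞ f)
    (hg : ∀ x, ∃ g : V → N, ContMDiffAt 𝓘(ℝ, V) 𝓘(ℝ, E) ∞ g (f x) ∧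
      ∀ᶠ v in nhds (f x), ∀ y, f y = v → g v = y) :
    IsSubmanifoldDiffeomorphicTo (Set.range f) 𝓘(ℝ, E) N := by
  have hemb := (isSmoothEmbedding_of_left_inverse hf hg).isEmbedding
  let h : Set.range f ≃ₜ N := hemb.toHomeomorph.symm
  have hfh : ∀ x, f (h x) = x := fun x =>
    congrArg Subtype.val (hemb.toHomeomorph.apply_symm_apply x)
  -- `IsSubmanifoldDiffeomorphicTo` asks for an atlas modelled on some `ℝ^d`, so the model space of
  -- `N` is identified with one.
  let l := toEuclidean (E := E)
  let := transportChartedSpace h l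
  have := isManifold_transport h l
  let D := transportDiffeomorph h l
  have hD : ∀ x, D x = h x := fun _ => rfl
  refine ⟨Module.finrank ℝ E, transportChartedSpace h l, isManifold_transport h l, ?_, ⟨D⟩⟩
  refine isSmoothEmbedding_of_left_inverse ?_ fun x => ?_
  · refine (hf.comp D.contMDiff).congr fun x => ?_
    rw [Function.comp_apply, hD, hfh]
  · obtain ⟨g, hg, hgf⟩ := hg (h x)
    rw [hfh] at hg hgf
    refine ⟨D.symm ∘ g, D.symm.contMDiff.contMDiffAt.comp _ hg, ?_⟩
    filter_upwards [hgf] with v hv y hy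
    rw [Function.comp_apply, hv (h y) (by rw [hfh, hy]), ← hD, D.symm_apply_apply]

/-! ### Orthogonal projectors -/

section Projector

variable {s k : ℕ}

open scoped ComplexOrder in
theorem Matrix.isUnit_conjTranspose_mul_self {G : Matrix (Fin s) (Fin k) ℂ}
    (hG : Function.Injective G.mulVec) : IsUnit (G.conjTranspose * G) :=
  (Matrix.PosDef.conjTranspose_mul_self G hG).isUnit

/-- The orthogonal projector onto the column space of a matrix with independent columns. -/
noncomputable def columnProjector (G : Matrix (Fin s) (Fin k) ℂ) : Matrix (Fin s) (Fin s) ℂ :=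
  G * (G.conjTranspose * G)⁻¹ * G.conjTranspose

theorem columnProjector_mul_self {G : Matrix (Fin s) (Fin k) ℂ}
    (hG : Function.Injective G.mulVec) : columnProjector G * G = G := by
  have h := (Matrix.isUnit_iff_isUnit_det _).1 (Matrix.isUnit_conjTranspose_mul_self hG)
  rw [columnProjector, Matrix.mul_assoc, Matrix.mul_assoc, Matrix.nonsing_inv_mul _ h,
    Matrix.mul_one]

theorem isStarProjection_columnProjector {G : Matrix (Fin s) (Fin k) ℂ}
    (hG : Function.Injective G.mulVec) : IsStarProjection (columnProjector G) := by
  constructor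
  · rw [IsIdempotentElem]
    nth_rw 2 [columnProjector]
    rw [← Matrix.mul_assoc, ← Matrix.mul_assoc, columnProjector_mul_self hG, columnProjector]
  · rw [IsSelfAdjoint, Matrix.star_eq_conjTranspose, columnProjector]
    simp [Matrix.conjTranspose_nonsing_inv, Matrix.mul_assoc]

theorem range_columnProjector {G : Matrix (Fin s) (Fin k) ℂ}
    (hG : Function.Injective G.mulVec) :
    LinearMap.range (Matrix.toLin' (columnProjector G)) = LinearMap.range (Matrix.toLin' G) := by
  apply le_antisymm
  · rw [columnProjector, Matrix.mul_assoc, Matrix.toLin'_mul]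
    exact LinearMap.range_comp_le_range _ _
  · nth_rw 1 [← columnProjector_mul_self hG]
    rw [Matrix.toLin'_mul]
    exact LinearMap.range_comp_le_range _ _

theorem IsStarProjection.mulVec_eq_self {P : Matrix (Fin s) (Fin s) ℂ} (hP : IsStarProjection P)
    {v : Fin s → ℂ} (hv : v ∈ LinearMap.range (Matrix.toLin' P)) : P.mulVec v = v := by
  obtain ⟨w, rfl⟩ := hv
  rw [Matrix.toLin'_apply, Matrix.mulVec_mulVec, hP.isIdempotentElem.eq]

/-- An orthogonal projector is determined by its range. -/
theorem IsStarProjection.eq_of_range_eq {P P' : Matrix (Fin s) (Fin s) ℂ}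
    (hP : IsStarProjection P) (hP' : IsStarProjection P')
    (h : LinearMap.range (Matrix.toLin' P) = LinearMap.range (Matrix.toLin' P')) : P = P' := by
  have key : ∀ {A B : Matrix (Fin s) (Fin s) ℂ}, IsStarProjection A →
      LinearMap.range (Matrix.toLin' A) = LinearMap.range (Matrix.toLin' B) → A * B = B := by
    intro A B hA hAB
    apply Matrix.toLin'.injective
    refine LinearMap.ext fun v => ?_
    rw [Matrix.toLin'_mul]
    exact hA.mulVec_eq_self (by rw [hAB]; exact LinearMap.mem_range_self _ _)
  have h1 := key hP h
  -- The adjoint of `P' * P = P` is `P * P' = P`, while `h1` says `P * P' = P'`.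
  have h2 := congrArg star (key hP' h.symm)
  rw [star_mul, hP.isSelfAdjoint.star_eq, hP'.isSelfAdjoint.star_eq] at h2
  exact h2.symm.trans h1

/-- Turns a trace condition on projectors into a condition on dimensions, hence on natural numbers
at most `s`. -/
theorem IsStarProjection.trace_eq_finrank {P : Matrix (Fin s) (Fin s) ℂ}
    (hP : IsStarProjection P) :
    P.trace = (Module.finrank ℂ (LinearMap.range (Matrix.toLin' P)) : ℂ) := by
  have h : LinearMap.IsProj (LinearMap.range (Matrix.toLin' P)) (Matrix.toLin' P) :=
    ⟨fun v => LinearMap.mem_range_self _ v, fun v hv => hP.mulVec_eq_self hv⟩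
  rw [← h.trace, Matrix.trace_toLin'_eq]

/-- The reflection `1 - 2P` is unitary, so its entries have modulus at most `1`, and `P` is half of
`1 - (1 - 2P)`. -/
theorem IsStarProjection.norm_entry_le_one {P : Matrix (Fin s) (Fin s) ℂ}
    (hP : IsStarProjection P) (i j : Fin s) : ‖P i j‖ ≤ 1 := by
  have hU : 1 - (2 : ℂ) • P ∈ Matrix.unitaryGroup (Fin s) ℂ := by
    have h1 : star P = P := hP.isSelfAdjoint
    have h2 : P * P = P := hP.isIdempotentElem
    rw [Matrix.mem_unitaryGroup_iff]
    simp only [star_sub, star_one, star_smul, h1, mul_sub, sub_mul, mul_one, one_mul,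
      smul_mul_assoc, mul_smul_comm, h2, star_ofNat]
    module
  have h3 := entry_norm_bound_of_unitary hU i j
  have h4 : P i j = (1 / 2 : ℂ) * ((1 : Matrix (Fin s) (Fin s) ℂ) i j -
      (1 - (2 : ℂ) • P) i j) := by
    simp
  have h5 : ‖(1 : Matrix (Fin s) (Fin s) ℂ) i j‖ ≤ 1 := by
    rw [Matrix.one_apply]; split_ifs <;> simp
  rw [h4, norm_mul]
  have h6 := norm_sub_le ((1 : Matrix (Fin s) (Fin s) ℂ) i j) ((1 - (2 : ℂ) • P) i j)
  norm_num at *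
  linarith

/-- The orthogonal projectors of a given trace form a compact set. -/
theorem isCompact_setOf_isStarProjection (z : ℂ) :
    IsCompact {P : Matrix (Fin s) (Fin s) ℂ | IsStarProjection P ∧ P.trace = z} := by
  have hb : IsCompact {P : Matrix (Fin s) (Fin s) ℂ | ∀ i j, P i j ∈ Metric.closedBall 0 1} := by
    have h : IsCompact (Set.pi Set.univ fun _ : Fin s => Set.pi Set.univ fun _ : Fin s =>
        Metric.closedBall (0 : ℂ) 1) :=
      isCompact_univ_pi fun _ => isCompact_univ_pi fun _ => isCompact_closedBall _ _
    change IsCompact {P : Fin s → Fin s → ℂ | ∀ i j, P i j ∈ Metric.closedBall 0 1}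
    refine (congrArg IsCompact (Set.ext fun P => ?_)).mp h
    simp only [Set.mem_ofPred_eq, Set.mem_pi, Set.mem_univ, true_imp_iff]
  refine hb.of_isClosed_subset ?_ fun P hP i j => ?_
  · simp only [isStarProjection_iff, IsIdempotentElem, IsSelfAdjoint, Set.ofPred_and]
    refine ((isClosed_eq ?_ ?_).inter (isClosed_eq ?_ ?_)).inter (isClosed_eq ?_ ?_) <;> fun_prop
  · rw [mem_closedBall_zero_iff]
    exact hP.1.norm_entry_le_one i j

end Projector

/-! ### The Grassmannian realised by orthogonal projectors -/

namespace Gr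

variable {k s : ℕ}

theorem exists_param_eq (W : Gr k s) : ∃ (e : Frame k s) (T : Model k s), param e T = W := by
  obtain ⟨e, he⟩ := exists_frame W
  rw [chart_source] at he
  exact ⟨e, he⟩

/-- The matrix of the graph map. -/
noncomputable def graphMatrix (e : Frame k s) (T : Model k s) : Matrix (Fin s) (Fin k) ℂ :=
  LinearMap.toMatrix' (graphMap e T)

theorem graphMatrix_injective (e : Frame k s) (T : Model k s) :
    Function.Injective (graphMatrix e T).mulVec := by
  intro x y h
  apply graphMap_injective e T
  simpa [graphMatrix, LinearMap.toMatrix'_mulVec] using h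

theorem exists_isStarProjection (W : Gr k s) : ∃ P : Matrix (Fin s) (Fin s) ℂ,
    IsStarProjection P ∧ LinearMap.range (Matrix.toLin' P) = W.1 := by
  obtain ⟨e, T, rfl⟩ := exists_param_eq W
  refine ⟨_, isStarProjection_columnProjector (graphMatrix_injective e T), ?_⟩
  rw [range_columnProjector (graphMatrix_injective e T), graphMatrix, Matrix.toLin'_toMatrix']
  rfl

/-- The orthogonal projector onto a subspace. -/
noncomputable def proj (W : Gr k s) : Matrix (Fin s) (Fin s) ℂ := (exists_isStarProjection W).choose

theorem isStarProjection_proj (W : Gr k s) : IsStarProjection (proj W) :=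
  (exists_isStarProjection W).choose_spec.1

theorem range_proj (W : Gr k s) : LinearMap.range (Matrix.toLin' (proj W)) = W.1 :=
  (exists_isStarProjection W).choose_spec.2

theorem trace_proj (W : Gr k s) : (proj W).trace = k := by
  rw [(isStarProjection_proj W).trace_eq_finrank, range_proj, W.2]

theorem proj_mulVec_of_mem {W : Gr k s} {v : Fin s → ℂ} (hv : v ∈ W.1) :
    (proj W).mulVec v = v :=
  (isStarProjection_proj W).mulVec_eq_self (by rwa [range_proj])

theorem exists_proj_eq {P : Matrix (Fin s) (Fin s) ℂ} (hP : IsStarProjection P)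
    (hk : P.trace = k) : ∃ W : Gr k s, proj W = P := by
  refine ⟨⟨LinearMap.range (Matrix.toLin' P), ?_⟩, ?_⟩
  · rw [hP.trace_eq_finrank] at hk; exact_mod_cast hk
  · exact (isStarProjection_proj _).eq_of_range_eq hP (range_proj _)

/-- `proj` is obtained by choice; uniqueness of the projector with given range yields an explicit
formula in each graph chart. -/
theorem proj_param (e : Frame k s) (T : Model k s) :
    proj (param e T) = columnProjector (graphMatrix e T) := by
  refine (isStarProjection_proj _).eq_of_range_eq
    (isStarProjection_columnProjector (graphMatrix_injective e T)) ?_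
  rw [range_proj, range_columnProjector (graphMatrix_injective e T), graphMatrix,
    Matrix.toLin'_toMatrix']
  rfl

theorem contDiff_graphMatrix (e : Frame k s) : ContDiff ℝ ∞ (graphMatrix e) := by
  have h1 : ContDiff ℂ ∞ fun T : Model k s =>
      (e.toContinuousLinearMap ∘L (ContinuousLinearMap.id ℂ (Fin k → ℂ)).prod T) :=
    contDiff_const.clm_comp contDiff_graph
  let l : ((Fin k → ℂ) →L[ℂ] (Fin s → ℂ)) →ₗ[ℂ] Matrix (Fin s) (Fin k) ℂ :=
    (LinearMap.toMatrix' (R := ℂ)).toLinearMap ∘ₗ ContinuousLinearMap.coeLM ℂ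
  have h2 : ContDiff ℂ ∞ l := (LinearMap.toContinuousLinearMap l).contDiff
  exact (h2.comp h1).restrict_scalars ℝ

theorem _root_.contDiff_matrix_mul {a b c : ℕ} :
    ContDiff ℝ ∞ fun p : Matrix (Fin a) (Fin b) ℂ × Matrix (Fin b) (Fin c) ℂ => p.1 * p.2 := by
  refine IsBoundedBilinearMap.contDiff (𝕜 := ℝ) ⟨?_, ?_, ?_, ?_, 1, one_pos, ?_⟩
  · intro x y z; exact Matrix.add_mul _ _ _
  · intro r x y; exact Matrix.smul_mul _ _ _
  · intro x y z; exact Matrix.mul_add _ _ _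
  · intro r x y; exact Matrix.mul_smul _ _ _
  · intro x y; simpa using Matrix.frobenius_norm_mul x y

theorem _root_.contDiff_matrix_conjTranspose {a b : ℕ} :
    ContDiff ℝ ∞ fun p : Matrix (Fin a) (Fin b) ℂ => p.conjTranspose := by
  let l : Matrix (Fin a) (Fin b) ℂ →ₗ[ℝ] Matrix (Fin b) (Fin a) ℂ :=
    { toFun := Matrix.conjTranspose
      map_add' := Matrix.conjTranspose_add
      map_smul' := fun r x => by simp }
  exact (LinearMap.toContinuousLinearMap l).contDiff

/-- In `G (G* G)⁻¹ G*` the Gram matrix is always invertible, so inversion is smooth there. The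
conjugate transpose restricts smoothness to real scalars. -/
theorem contDiff_proj_param (e : Frame k s) : ContDiff ℝ ∞ fun T => proj (param e T) := by
  simp only [proj_param, columnProjector]
  have hG := contDiff_graphMatrix e
  have hH : ContDiff ℝ ∞ fun T => (graphMatrix e T).conjTranspose :=
    contDiff_matrix_conjTranspose.comp hG
  have hHG : ContDiff ℝ ∞ fun T => (graphMatrix e T).conjTranspose * graphMatrix e T :=
    contDiff_matrix_mul.comp (hH.prodMk hG)
  have hI : ContDiff ℝ ∞ fun T =>
      ((graphMatrix e T).conjTranspose * graphMatrix e T)⁻¹ := by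
    rw [contDiff_iff_contDiffAt]
    intro T
    obtain ⟨u, hu⟩ := Matrix.isUnit_conjTranspose_mul_self (graphMatrix_injective e T)
    simp only [Matrix.nonsing_inv_eq_ringInverse]
    refine ContDiffAt.fun_comp T ?_ hHG.contDiffAt
    have : CompleteSpace (Matrix (Fin k) (Fin k) ℂ) := FiniteDimensional.complete ℂ _
    rw [← hu]
    exact contDiffAt_ringInverse ℝ u
  exact contDiff_matrix_mul.comp ((contDiff_matrix_mul.comp (hG.prodMk hI)).prodMk hH)

/-- The graph chart of a splitting, as a chart of the manifold. -/
noncomputable def chartHomeo (e : Frame k s) : OpenPartialHomeomorph (Gr k s) (Model k s) :=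
  (core k s).openPartialHomeomorph (chart e) ⟨e, rfl⟩

theorem chartHomeo_mem_maximalAtlas (e : Frame k s) :
    chartHomeo e ∈ IsManifold.maximalAtlas 𝓘(ℝ, Model k s) ∞ (Gr k s) :=
  IsManifold.subset_maximalAtlas (Set.mem_iUnion₂.2 ⟨chart e, ⟨e, rfl⟩, rfl⟩)

theorem contMDiff_param (e : Frame k s) :
    ContMDiff 𝓘(ℝ, Model k s) 𝓘(ℝ, Model k s) ∞ (param e) := by
  have h := contMDiffOn_symm_of_mem_maximalAtlas (chartHomeo_mem_maximalAtlas e)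
  -- The target of a graph chart is the whole model space, so its inverse `param e` is defined
  -- everywhere.
  rw [← contMDiffOn_univ]
  exact h

theorem contMDiff_comp_proj {V : Type*} [NormedAddCommGroup V] [NormedSpace ℝ V]
    {A : Matrix (Fin s) (Fin s) ℂ → V} (hA : ContDiff ℝ ∞ A) :
    ContMDiff 𝓘(ℝ, Model k s) 𝓘(ℝ, V) ∞ fun W : Gr k s => A (proj W) := by
  intro W
  obtain ⟨e, T, rfl⟩ := exists_param_eq W
  have hs : (chartHomeo e).source = Set.range (param e) := chart_source e
  have h := contMDiffOn_of_mem_maximalAtlas (chartHomeo_mem_maximalAtlas e)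
  have h1 := (hA.comp (contDiff_proj_param e)).contMDiff.comp_contMDiffOn h
  refine (h1.congr fun W hW => ?_).contMDiffAt
    ((chartHomeo e).open_source.mem_nhds (hs ▸ ⟨T, rfl⟩))
  exact congrArg (fun W => A (proj W)) ((chartHomeo e).left_inv hW).symm

/-- The `ℂ^k`-component of a matrix, along the graph of `T`. -/
noncomputable def projectorDenom (e : Frame k s) (T : Model k s) (P : Matrix (Fin s) (Fin s) ℂ) :
    (Fin k → ℂ) →L[ℂ] (Fin k → ℂ) :=
  ContinuousLinearMap.fst ℂ _ _ ∘L e.symm.toContinuousLinearMap ∘L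
      (Matrix.toLin' P).toContinuousLinearMap ∘L (graphMap e T).toContinuousLinearMap

/-- A local smooth inverse of `proj`: in the splitting `e`, the linear map whose graph is the range
of a projector close to the projector onto the graph of `T`. -/
noncomputable def graphOfProjector (e : Frame k s) (T : Model k s) (P : Matrix (Fin s) (Fin s) ℂ) :
    Model k s :=
  (ContinuousLinearMap.snd ℂ _ _ ∘L e.symm.toContinuousLinearMap ∘L
      (Matrix.toLin' P).toContinuousLinearMap ∘L (graphMap e T).toContinuousLinearMap) ∘L
    Ring.inverse (projectorDenom e T P)

/-- The projector fixes the graph of `T` pointwise. Invertibility being open, the denominator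
remains invertible near this projector. -/
theorem projectorDenom_proj_param (e : Frame k s) (T : Model k s) :
    projectorDenom e T (proj (param e T)) = 1 := by
  ext1 x
  have h : (proj (param e T)).mulVec (graphMap e T x) = graphMap e T x :=
    proj_mulVec_of_mem (LinearMap.mem_range_self _ x)
  change (e.symm ((proj (param e T)).mulVec (graphMap e T x))).1 = x
  rw [h, graphMap_apply, e.symm_apply_apply]

theorem contDiff_toLin'_toContinuousLinearMap :
    ContDiff ℂ ∞ fun P : Matrix (Fin s) (Fin s) ℂ => (Matrix.toLin' P).toContinuousLinearMap := by
  let l : Matrix (Fin s) (Fin s) ℂ →ₗ[ℂ] ((Fin s → ℂ) →L[ℂ] (Fin s → ℂ)) :=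
    LinearMap.toContinuousLinearMap.toLinearMap ∘ₗ Matrix.toLin'.toLinearMap
  exact (LinearMap.toContinuousLinearMap l).contDiff

theorem contDiff_projectorDenom (e : Frame k s) (T : Model k s) :
    ContDiff ℂ ∞ (projectorDenom e T) :=
  contDiff_const.clm_comp (contDiff_const.clm_comp
    (contDiff_toLin'_toContinuousLinearMap.clm_comp contDiff_const))

theorem contDiffAt_graphOfProjector (e : Frame k s) (T : Model k s)
    {P : Matrix (Fin s) (Fin s) ℂ} (hP : IsUnit (projectorDenom e T P)) :
    ContDiffAt ℝ ∞ (graphOfProjector e T) P := by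
  have h1 : ContDiffAt ℂ ∞ (fun P => Ring.inverse (projectorDenom e T P)) P := by
    obtain ⟨u, hu⟩ := hP
    exact ContDiffAt.fun_comp P (by rw [← hu]; exact contDiffAt_ringInverse ℂ u)
      (contDiff_projectorDenom e T).contDiffAt
  have h2 : ContDiff ℂ ∞ fun P : Matrix (Fin s) (Fin s) ℂ =>
      (ContinuousLinearMap.snd ℂ _ _ ∘L e.symm.toContinuousLinearMap ∘L
      (Matrix.toLin' P).toContinuousLinearMap ∘L (graphMap e T).toContinuousLinearMap) :=
    contDiff_const.clm_comp (contDiff_const.clm_comp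
      (contDiff_toLin'_toContinuousLinearMap.clm_comp contDiff_const))
  exact (h2.contDiffAt.clm_comp h1).restrict_scalars ℝ

/-- Each vector of the new graph is `proj W` applied to a vector of the graph of `T`, hence lies in
`W`; both spaces have dimension `k`. -/
theorem param_graphOfProjector (e : Frame k s) (T : Model k s) {W : Gr k s}
    (hW : IsUnit (projectorDenom e T (proj W))) :
    param e (graphOfProjector e T (proj W)) = W := by
  refine Subtype.ext (Submodule.eq_of_le_of_finrank_eq ?_ ?_)
  · rintro _ ⟨x, rfl⟩
    have h : projectorDenom e T (proj W) (Ring.inverse (projectorDenom e T (proj W)) x) = x :=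
      DFunLike.congr_fun (Ring.mul_inverse_cancel _ hW) x
    set y := Ring.inverse (projectorDenom e T (proj W)) x with hy
    have h1 : e.symm ((proj W).mulVec (graphMap e T y)) =
        (x, graphOfProjector e T (proj W) x) := Prod.ext h rfl
    rw [graphMap_apply, ← h1, e.apply_symm_apply, ← range_proj W]
    exact LinearMap.mem_range_self (Matrix.toLin' (proj W)) _
  · rw [(param e _).2, W.2]

/-- The image of the Grassmannian, realised by orthogonal projectors, under a smooth map with a
smooth retraction is an embedded submanifold diffeomorphic to the Grassmannian. -/
theorem isSubmanifoldDiffeomorphicTo_range_proj {V : Type} [NormedAddCommGroup V]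
    [NormedSpace ℝ V] [FiniteDimensional ℝ V] {A : Matrix (Fin s) (Fin s) ℂ → V}
    {B : V → Matrix (Fin s) (Fin s) ℂ} (hA : ContDiff ℝ ∞ A) (hB : ContDiff ℝ ∞ B)
    (hBA : ∀ W : Gr k s, B (A (proj W)) = proj W) :
    IsSubmanifoldDiffeomorphicTo (Set.range fun W : Gr k s => A (proj W)) 𝓘(ℝ, Model k s)
      (Gr k s) := by
  have : FiniteDimensional ℝ (Model k s) := FiniteDimensional.trans ℝ ℂ _
  refine isSubmanifoldDiffeomorphicTo_range (contMDiff_comp_proj hA) fun W => ?_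
  obtain ⟨e, T, rfl⟩ := exists_param_eq W
  have h1 : IsUnit (projectorDenom e T (B (A (proj (param e T))))) := by
    rw [hBA, projectorDenom_proj_param]; exact isUnit_one
  refine ⟨fun X => param e (graphOfProjector e T (B X)), ?_, ?_⟩
  · have h2 := (contDiffAt_graphOfProjector e T h1).comp _ hB.contDiffAt
    exact (contMDiff_param e).contMDiffAt.comp _ h2.contMDiffAt
  · have hc : Continuous fun X => projectorDenom e T (B X) :=
      (contDiff_projectorDenom e T).continuous.comp hB.continuous
    -- Invertibility of the denominator at `X` depends on `X` alone, so every `W` mapped to `X` is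
    -- recovered, wherever it lies in the Grassmannian.
    filter_upwards [(Units.isOpen.preimage hc).mem_nhds h1] with X hX W hW
    subst hW
    rw [Set.mem_preimage, hBA] at hX
    rw [hBA]
    exact param_graphOfProjector e T hX

end Gr

/-! ### Unitary diagonalisation of unitary matrices -/

section Diagonalization

variable {n : ℕ}

/-- The matrix with eigenvalues `d` and eigenvectors the columns of `U`. -/
def conjDiagonal (U : Matrix (Fin n) (Fin n) ℂ) (d : Fin n → ℂ) : Matrix (Fin n) (Fin n) ℂ :=
  U * Matrix.diagonal d * star U

theorem Matrix.IsHermitian.exists_conjDiagonal {H : Matrix (Fin n) (Fin n) ℂ}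
    (hH : H.IsHermitian) : ∃ U ∈ Matrix.unitaryGroup (Fin n) ℂ, ∃ θ : Fin n → ℝ,
      H = conjDiagonal U fun i => (θ i : ℂ) :=
  ⟨hH.eigenvectorUnitary, hH.eigenvectorUnitary.2, hH.eigenvalues, by
    conv_lhs => rw [hH.spectral_theorem]
    rfl⟩

/-- The unit circle is infinite and the spectrum finite. The point `z` serves to rotate `Q` so that
a Cayley transform exists. -/
theorem exists_norm_eq_one_isUnit_sub (Q : Matrix (Fin n) (Fin n) ℂ) :
    ∃ z : ℂ, ‖z‖ = 1 ∧ IsUnit (Matrix.scalar (Fin n) z - Q) := by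
  have hinf : (Metric.sphere (0 : ℂ) 1).Infinite :=
    (isConnected_sphere (by simp) (0 : ℂ) zero_le_one).isPreconnected.infinite_of_nontrivial
      ⟨1, by simp, -1, by simp, by norm_num⟩
  obtain ⟨z, hz, hzQ⟩ := hinf.exists_notMem_finset Q.charpoly.roots.toFinset
  refine ⟨z, by simpa using hz, ?_⟩
  rw [Matrix.isUnit_iff_isUnit_det, isUnit_iff_ne_zero, ← Matrix.eval_charpoly]
  intro h
  exact hzQ (by simpa [Polynomial.mem_roots, (Matrix.charpoly_monic Q).ne_zero] using h)

/-- A unitary matrix is unitarily diagonalisable. -/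
theorem exists_conjDiagonal_of_mem_unitaryGroup {Q : Matrix (Fin n) (Fin n) ℂ}
    (hQ : Q ∈ Matrix.unitaryGroup (Fin n) ℂ) :
    ∃ U ∈ Matrix.unitaryGroup (Fin n) ℂ, ∃ μ : Fin n → ℂ, Q = conjDiagonal U μ := by
  -- Cayley transform of a multiple of `Q` that avoids the eigenvalue `-1`
  obtain ⟨z, hz, hzQ⟩ := exists_norm_eq_one_isUnit_sub Q
  have hz0 : z ≠ 0 := fun h => by simp [h] at hz
  have hzz : z⁻¹ * star z⁻¹ = 1 := by
    rw [Complex.star_def, Complex.mul_conj, Complex.normSq_eq_norm_sq, norm_inv, hz]; simp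
  set R : Matrix (Fin n) (Fin n) ℂ := -(z⁻¹ • Q) with hR
  have hRR : star R * R = 1 := by
    rw [hR, star_neg, star_smul, neg_mul_neg, smul_mul_assoc, mul_smul_comm, smul_smul,
      (Matrix.mem_unitaryGroup_iff').1 hQ, mul_comm, hzz, one_smul]
  have hA : IsUnit (1 + R) := by
    have : 1 + R = z⁻¹ • (Matrix.scalar (Fin n) z - Q) := by
      rw [hR, smul_sub, ← sub_eq_add_neg]
      congr 1
      ext i j
      by_cases hij : i = j <;> simp [Matrix.one_apply, hij, hz0]
    rw [this]
    exact hzQ.smul (Units.mk0 z⁻¹ (inv_ne_zero hz0))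
  have hAd := (Matrix.isUnit_iff_isUnit_det _).1 hA
  -- This is `i (1 - R) (1 + R)⁻¹`, since `(1 + R)* (1 - R) = R* - R` for unitary `R`; the
  -- congruence form makes it visibly Hermitian.
  set H : Matrix (Fin n) (Fin n) ℂ :=
    star (1 + R)⁻¹ * (Complex.I • (star R - R)) * (1 + R)⁻¹ with hHdef
  have hH : H.IsHermitian := by
    refine Matrix.isHermitian_conjTranspose_mul_mul _ ?_
    rw [Matrix.IsHermitian, ← Matrix.star_eq_conjTranspose, star_smul, star_sub, star_star,
      Complex.star_def, Complex.conj_I]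
    module
  have hHA : H * (1 + R) = Complex.I • (1 - R) := by
    have h1 : Complex.I • (star R - R) = star (1 + R) * (Complex.I • (1 - R)) := by
      rw [mul_smul_comm, star_add, star_one, add_mul, one_mul, mul_sub, mul_one, hRR]
      congr 1; abel
    have h2 : star (1 + R)⁻¹ * star (1 + R) = 1 := by
      rw [← star_mul, Matrix.mul_nonsing_inv _ hAd, star_one]
    rw [hHdef, Matrix.mul_assoc, Matrix.nonsing_inv_mul _ hAd, mul_one, h1, ← mul_assoc, h2,
      one_mul]
  obtain ⟨V, hV, θ, hθ⟩ := hH.exists_conjDiagonal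
  have hVV := (Matrix.mem_unitaryGroup_iff').1 hV
  have hVV' := (Matrix.mem_unitaryGroup_iff).1 hV
  have hd : ∀ j, (Complex.I + θ j : ℂ) ≠ 0 := fun j h => by
    simpa using congrArg Complex.im h
  -- Inverting the Cayley transform: `θ (1 + r) = i (1 - r)` gives `r = (i - θ) / (i + θ)`, the
  -- denominator having imaginary part `1`.
  have hN : star V * R = Matrix.diagonal (fun j => (Complex.I - θ j) / (Complex.I + θ j)) *
      star V := by
    have h1 : Matrix.diagonal (fun j => (θ j : ℂ)) * (star V + star V * R) =
        Complex.I • (star V - star V * R) := by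
      have h := congrArg (star V * ·) hHA
      simp only [hθ, conjDiagonal] at h
      rw [mul_smul_comm, mul_sub, mul_one] at h
      rw [← h, ← mul_assoc, ← mul_assoc, ← mul_assoc, hVV, one_mul, mul_assoc, mul_add (star V), mul_one]
    ext j k
    have h2 := congrFun (congrFun h1 j) k
    rw [Matrix.diagonal_mul] at h2 ⊢
    simp only [Matrix.add_apply, Matrix.smul_apply, Matrix.sub_apply, smul_eq_mul] at h2
    have := hd j
    field_simp
    linear_combination h2
  refine ⟨V, hV, fun j => -z * ((Complex.I - θ j) / (Complex.I + θ j)), ?_⟩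
  have hQR : Q = -z • R := by
    rw [hR, neg_smul_neg, smul_smul, mul_inv_cancel₀ hz0, one_smul]
  have hRV : R = V * (star V * R) := by rw [← mul_assoc, hVV', one_mul]
  rw [hQR, hRV, hN, conjDiagonal, ← mul_assoc]
  have : Matrix.diagonal (fun j => -z * ((Complex.I - θ j) / (Complex.I + θ j))) =
      -z • Matrix.diagonal (fun j => (Complex.I - θ j) / (Complex.I + θ j)) := by
    rw [← Matrix.diagonal_smul]; rfl
  rw [this, mul_smul_comm, smul_mul_assoc]

theorem conjDiagonal_mul_self {U : Matrix (Fin n) (Fin n) ℂ}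
    (hU : U ∈ Matrix.unitaryGroup (Fin n) ℂ) (d : Fin n → ℂ) :
    conjDiagonal U d * U = U * Matrix.diagonal d := by
  rw [conjDiagonal, mul_assoc, (Matrix.mem_unitaryGroup_iff').1 hU, mul_one]

theorem eq_conjDiagonal {U A : Matrix (Fin n) (Fin n) ℂ}
    (hU : U ∈ Matrix.unitaryGroup (Fin n) ℂ) {d : Fin n → ℂ}
    (h : A * U = U * Matrix.diagonal d) : A = conjDiagonal U d := by
  rw [conjDiagonal, ← h, mul_assoc, (Matrix.mem_unitaryGroup_iff).1 hU, mul_one]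

theorem star_conjDiagonal (U : Matrix (Fin n) (Fin n) ℂ) (d : Fin n → ℂ) :
    star (conjDiagonal U d) = conjDiagonal U (star d) := by
  simp [conjDiagonal, Matrix.star_eq_conjTranspose, Matrix.mul_assoc]

theorem conjDiagonal_mul {U : Matrix (Fin n) (Fin n) ℂ}
    (hU : U ∈ Matrix.unitaryGroup (Fin n) ℂ) (d d' : Fin n → ℂ) :
    conjDiagonal U d * conjDiagonal U d' = conjDiagonal U (d * d') := by
  refine eq_conjDiagonal hU ?_
  rw [mul_assoc, conjDiagonal_mul_self hU, ← mul_assoc, conjDiagonal_mul_self hU, mul_assoc,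
    Matrix.diagonal_mul_diagonal]
  rfl

theorem conjDiagonal_add (U : Matrix (Fin n) (Fin n) ℂ) (d d' : Fin n → ℂ) :
    conjDiagonal U d + conjDiagonal U d' = conjDiagonal U (d + d') := by
  rw [conjDiagonal, conjDiagonal, conjDiagonal, ← add_mul, ← mul_add, Matrix.diagonal_add]
  rfl

theorem conjDiagonal_smul (U : Matrix (Fin n) (Fin n) ℂ) (c : ℂ) (d : Fin n → ℂ) :
    c • conjDiagonal U d = conjDiagonal U (c • d) := by
  rw [conjDiagonal, conjDiagonal, Matrix.diagonal_smul, mul_smul_comm, smul_mul_assoc]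

theorem conjDiagonal_one {U : Matrix (Fin n) (Fin n) ℂ}
    (hU : U ∈ Matrix.unitaryGroup (Fin n) ℂ) : conjDiagonal U (fun _ => 1) = 1 := by
  rw [conjDiagonal, Matrix.diagonal_one, mul_one, (Matrix.mem_unitaryGroup_iff).1 hU]

theorem trace_conjDiagonal {U : Matrix (Fin n) (Fin n) ℂ}
    (hU : U ∈ Matrix.unitaryGroup (Fin n) ℂ) (d : Fin n → ℂ) :
    (conjDiagonal U d).trace = ∑ i, d i := by
  rw [conjDiagonal, Matrix.trace_mul_comm, ← mul_assoc, (Matrix.mem_unitaryGroup_iff').1 hU,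
    one_mul, Matrix.trace_diagonal]

theorem det_conjDiagonal {U : Matrix (Fin n) (Fin n) ℂ}
    (hU : U ∈ Matrix.unitaryGroup (Fin n) ℂ) (d : Fin n → ℂ) :
    (conjDiagonal U d).det = ∏ i, d i := by
  rw [conjDiagonal, Matrix.det_mul_comm, ← mul_assoc, (Matrix.mem_unitaryGroup_iff').1 hU,
    one_mul, Matrix.det_diagonal]

theorem roots_charpoly_conjDiagonal {U : Matrix (Fin n) (Fin n) ℂ}
    (hU : U ∈ Matrix.unitaryGroup (Fin n) ℂ) (d : Fin n → ℂ) :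
    (conjDiagonal U d).charpoly.roots = Finset.univ.val.map d := by
  rw [conjDiagonal, Matrix.charpoly_mul_comm, ← mul_assoc, (Matrix.mem_unitaryGroup_iff').1 hU,
    one_mul, Matrix.charpoly_diagonal, Polynomial.roots_prod]
  · simp
  · simp [Finset.prod_ne_zero_iff, Polynomial.X_sub_C_ne_zero]

theorem exp_conjDiagonal {U : Matrix (Fin n) (Fin n) ℂ}
    (hU : U ∈ Matrix.unitaryGroup (Fin n) ℂ) (d : Fin n → ℂ) :
    NormedSpace.exp (conjDiagonal U d) = conjDiagonal U fun i => Complex.exp (d i) := by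
  have h1 : IsUnit U := (Unitary.toUnits ⟨U, hU⟩).isUnit
  have h2 : star U = U⁻¹ := (Matrix.inv_eq_left_inv ((Matrix.mem_unitaryGroup_iff').1 hU)).symm
  rw [conjDiagonal, conjDiagonal, h2, Matrix.exp_conj _ _ h1, Matrix.exp_diagonal]
  congr 3
  funext i
  rw [Pi.coe_exp, Complex.exp_eq_exp_ℂ]

/-- Functional calculus: an eigenbasis of a diagonalisable matrix is one of its functions. -/
theorem conjDiagonal_comp_mul {m : ℕ} {U : Matrix (Fin n) (Fin n) ℂ}
    (hU : U ∈ Matrix.unitaryGroup (Fin n) ℂ) {d : Fin n → ℂ} {V : Matrix (Fin n) (Fin m) ℂ}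
    {c : Fin m → ℂ} (h : conjDiagonal U d * V = V * Matrix.diagonal c) (f : ℂ → ℂ) :
    conjDiagonal U (f ∘ d) * V = V * Matrix.diagonal (f ∘ c) := by
  have hUU := (Matrix.mem_unitaryGroup_iff').1 hU
  have hUU' := (Matrix.mem_unitaryGroup_iff).1 hU
  have h1 : Matrix.diagonal d * (star U * V) = star U * V * Matrix.diagonal c := by
    rw [Matrix.mul_assoc (star U), ← h, conjDiagonal, ← Matrix.mul_assoc (star U),
      ← mul_assoc (star U), ← mul_assoc (star U), hUU, one_mul, Matrix.mul_assoc]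
  have h2 : Matrix.diagonal (f ∘ d) * (star U * V) =
      star U * V * Matrix.diagonal (f ∘ c) := by
    ext i j
    have := congrFun (congrFun h1 i) j
    rw [Matrix.diagonal_mul, Matrix.mul_diagonal] at this ⊢
    -- A nonzero entry of `U* V` forces `d i = c j`, so `f` may be applied on both sides.
    by_cases hz : (star U * V) i j = 0
    · rw [hz]; simp
    · have : d i = c j := by
        rw [mul_comm] at this
        exact mul_left_cancel₀ hz this
      rw [Function.comp_apply, Function.comp_apply, this, mul_comm]
  rw [conjDiagonal, Matrix.mul_assoc, Matrix.mul_assoc, h2, ← Matrix.mul_assoc, ← Matrix.mul_assoc,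
    hUU', Matrix.one_mul]

theorem exists_eq_of_conjDiagonal_mulVec {U : Matrix (Fin n) (Fin n) ℂ}
    (hU : U ∈ Matrix.unitaryGroup (Fin n) ℂ) {d : Fin n → ℂ} {v : Fin n → ℂ} (hv : v ≠ 0) {z : ℂ}
    (h : (conjDiagonal U d).mulVec v = z • v) : ∃ i, z = d i := by
  have h1 : (Matrix.diagonal d).mulVec ((star U).mulVec v) = z • (star U).mulVec v := by
    rw [← Matrix.mulVec_smul, ← h, conjDiagonal, Matrix.mulVec_mulVec, Matrix.mulVec_mulVec,
      ← mul_assoc, ← mul_assoc, (Matrix.mem_unitaryGroup_iff').1 hU, one_mul]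
  have h2 : (star U).mulVec v ≠ 0 := fun h0 => hv <| by
    rw [← Matrix.one_mulVec v, ← (Matrix.mem_unitaryGroup_iff).1 hU, ← Matrix.mulVec_mulVec, h0,
      Matrix.mulVec_zero]
  obtain ⟨i, hi⟩ := Function.ne_iff.1 h2
  refine ⟨i, ?_⟩
  have h3 := congrFun h1 i
  rw [Matrix.mulVec_diagonal, Pi.smul_apply, smul_eq_mul] at h3
  exact (mul_right_cancel₀ hi h3).symm

/-- The exponential of an integral multiple of `2πi` times a projector is the identity. -/
theorem exp_smul_of_isStarProjection {R : Matrix (Fin n) (Fin n) ℂ} (hR : IsStarProjection R)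
    {c : ℂ} (hc : Complex.exp c = 1) : NormedSpace.exp (c • R) = 1 := by
  obtain ⟨U, hU, θ, hθ⟩ := Matrix.IsHermitian.exists_conjDiagonal (H := R) hR.isSelfAdjoint
  have h1 : ∀ i, (θ i : ℂ) = 0 ∨ (θ i : ℂ) = 1 := by
    intro i
    have h := hR.isIdempotentElem.eq
    rw [hθ, conjDiagonal_mul hU] at h
    have h2 := congrArg (star U * · * U) h
    simp only [mul_assoc, conjDiagonal_mul_self hU] at h2
    rw [← mul_assoc, ← mul_assoc, (Matrix.mem_unitaryGroup_iff').1 hU, one_mul, one_mul] at h2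
    have h3 := congrFun (Matrix.diagonal_injective h2) i
    exact (IsIdempotentElem.iff_eq_zero_or_one (p := (θ i : ℂ))).1 h3
  rw [hθ, conjDiagonal_smul, exp_conjDiagonal hU, ← conjDiagonal_one hU]
  congr 1
  funext i
  rw [Pi.smul_apply, smul_eq_mul]
  rcases h1 i with h | h <;> simp [h, hc]

end Diagonalization

/-! ### The principal logarithm, and all generalized principal logarithms -/

section PrincipalLog

variable {n : ℕ}

/-- The principal logarithm `L` of a unitary matrix, together with an isometry `J` onto its
eigenspace for the eigenvalue `-1`. -/
structure PrincipalLog (Q : Matrix (Fin n) (Fin n) ℂ) where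
  /-- The logarithm whose eigenvalues have imaginary part in `(-π, π]`. -/
  L : Matrix (Fin n) (Fin n) ℂ
  /-- An orthonormal basis of the eigenspace for the eigenvalue `-1`. -/
  J : Matrix (Fin n) (Fin (negOneMult Q)) ℂ
  conjTranspose_L : L.conjTranspose = -L
  trace_L : L.trace = 2 * Real.pi * Complex.I * argSum Q
  exp_L : NormedSpace.exp L = Q
  im_mem : ∀ {v : Fin n → ℂ} {z : ℂ}, v ≠ 0 → L.mulVec v = z • v →
    -Real.pi ≤ z.im ∧ z.im ≤ Real.pi
  conjTranspose_J_mul_J : J.conjTranspose * J = 1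
  L_mul_J : L * J = (Real.pi * Complex.I) • J
  -- Required for every eigenbasis of `Q`, so as to apply to the one supplied by an arbitrary
  -- logarithm.
  L_mul_of_eigenbasis : ∀ {V : Matrix (Fin n) (Fin n) ℂ} {c : Fin n → ℂ},
    Q * V = V * Matrix.diagonal c → L * V = V * Matrix.diagonal fun i => Complex.arg (c i) * Complex.I
  J_mul_of_eigenbasis : ∀ {V : Matrix (Fin n) (Fin n) ℂ} {c : Fin n → ℂ},
    Q * V = V * Matrix.diagonal c →
      J * J.conjTranspose * V = V * Matrix.diagonal fun i => if c i = -1 then 1 else 0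

theorem norm_eq_one_of_conjDiagonal_mem {U : Matrix (Fin n) (Fin n) ℂ}
    (hU : U ∈ Matrix.unitaryGroup (Fin n) ℂ) {d : Fin n → ℂ}
    (hQ : conjDiagonal U d ∈ Matrix.unitaryGroup (Fin n) ℂ) (i : Fin n) : ‖d i‖ = 1 := by
  have h := (Matrix.mem_unitaryGroup_iff).1 hQ
  rw [star_conjDiagonal, conjDiagonal_mul hU, ← conjDiagonal_one hU] at h
  have h2 := congrArg (· * U) h
  simp only [conjDiagonal_mul_self hU] at h2
  have h3 := congrArg (star U * ·) h2
  simp only [← mul_assoc, (Matrix.mem_unitaryGroup_iff').1 hU, one_mul] at h3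
  have h4 : d i * star (d i) = 1 := congrFun (Matrix.diagonal_injective h3) i
  rw [Complex.star_def, Complex.mul_conj, Complex.normSq_eq_norm_sq] at h4
  have h5 : ‖d i‖ ^ 2 = 1 := by exact_mod_cast h4
  exact (pow_eq_one_iff_of_nonneg (norm_nonneg _) two_ne_zero).1 h5

theorem negOneMult_conjDiagonal {U : Matrix (Fin n) (Fin n) ℂ}
    (hU : U ∈ Matrix.unitaryGroup (Fin n) ℂ) (d : Fin n → ℂ) :
    negOneMult (conjDiagonal U d) = (Finset.univ.filter fun i => d i = -1).card := by
  rw [negOneMult, ← Polynomial.count_roots, roots_charpoly_conjDiagonal hU, Multiset.count_map]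
  simp only [eq_comm (a := (-1 : ℂ))]
  rfl

theorem argSum_conjDiagonal {U : Matrix (Fin n) (Fin n) ℂ}
    (hU : U ∈ Matrix.unitaryGroup (Fin n) ℂ) (d : Fin n → ℂ) :
    2 * Real.pi * argSum (conjDiagonal U d) = ∑ i, Complex.arg (d i) := by
  rw [argSum, roots_charpoly_conjDiagonal hU, Multiset.map_map, ← mul_assoc,
    mul_one_div_cancel (by positivity), one_mul]
  rfl

/-- `L` and `J J*` are functions of `Q`: `i arg`, and the indicator of `-1`. The columns of `J` are
those of `U` with eigenvalue `-1`. -/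
theorem nonempty_principalLog {Q : Matrix (Fin n) (Fin n) ℂ}
    (hQ : Q ∈ Matrix.unitaryGroup (Fin n) ℂ) : Nonempty (PrincipalLog Q) := by
  obtain ⟨U, hU, d, rfl⟩ := exists_conjDiagonal_of_mem_unitaryGroup hQ
  have hUU := (Matrix.mem_unitaryGroup_iff').1 hU
  set F := Finset.univ.filter fun i => d i = -1 with hF
  let ι := F.orderEmbOfFin (negOneMult_conjDiagonal hU d).symm
  have hι : ∀ a, d (ι a) = -1 := fun a =>
    (Finset.mem_filter.1 (F.orderEmbOfFin_mem (negOneMult_conjDiagonal hU d).symm a)).2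
  let J : Matrix (Fin n) (Fin (negOneMult (conjDiagonal U d))) ℂ := U.submatrix id ι
  have hJJ : J * J.conjTranspose = conjDiagonal U fun i => if d i = -1 then 1 else 0 := by
    ext i j
    change _ = (U * Matrix.diagonal (fun i => if d i = -1 then (1 : ℂ) else 0) * star U) i j
    rw [Matrix.mul_apply, Matrix.mul_apply]
    simp only [Matrix.mul_diagonal, mul_ite, mul_one, mul_zero, ite_mul, zero_mul]
    rw [← Finset.sum_filter, ← hF,
      ← F.map_orderEmbOfFin_univ (negOneMult_conjDiagonal hU d).symm, Finset.sum_map]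
    rfl
  refine ⟨⟨conjDiagonal U ((fun z => Complex.arg z * Complex.I) ∘ d), J, ?_, ?_, ?_, ?_, ?_, ?_,
    ?_, ?_⟩⟩
  · rw [← Matrix.star_eq_conjTranspose, star_conjDiagonal, ← neg_one_smul ℂ, conjDiagonal_smul]
    congr 1
    funext i
    simp
  · rw [trace_conjDiagonal hU]
    have h := congrArg (fun x : ℝ => (x : ℂ)) (argSum_conjDiagonal hU d)
    simp only [Complex.ofReal_mul, Complex.ofReal_sum, Complex.ofReal_ofNat] at h
    simp only [Function.comp_apply]
    rw [← Finset.sum_mul, ← h]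
    ring
  · rw [exp_conjDiagonal hU]
    congr 1
    funext i
    have h := Complex.norm_mul_exp_arg_mul_I (d i)
    rw [norm_eq_one_of_conjDiagonal_mem hU hQ] at h
    simpa using h
  · intro v z hv h
    obtain ⟨i, rfl⟩ := exists_eq_of_conjDiagonal_mulVec hU hv h
    simpa using ⟨(Complex.neg_pi_lt_arg (d i)).le, Complex.arg_le_pi (d i)⟩
  · ext a b
    have h := congrFun (congrFun hUU (ι a)) (ι b)
    rw [Matrix.one_apply] at h ⊢
    simp only [ι.injective.eq_iff] at h
    exact h
  · ext i a
    have h := congrFun (congrFun (conjDiagonal_mul_self hU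
      ((fun z => Complex.arg z * Complex.I) ∘ d)) i) (ι a)
    rw [Matrix.mul_diagonal, Function.comp_apply, hι, Complex.arg_neg_one, mul_comm] at h
    exact h
  · intro V c h
    exact conjDiagonal_comp_mul hU h fun z => Complex.arg z * Complex.I
  · intro V c h
    rw [hJJ]
    exact conjDiagonal_comp_mul hU h fun z => if z = -1 then 1 else 0

theorem exists_conjDiagonal_of_skew {X : Matrix (Fin n) (Fin n) ℂ}
    (hX : X.conjTranspose = -X) : ∃ U ∈ Matrix.unitaryGroup (Fin n) ℂ, ∃ θ : Fin n → ℝ,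
      X = conjDiagonal U fun i => θ i * Complex.I := by
  have hH : (-Complex.I • X).IsHermitian := by
    rw [Matrix.IsHermitian, Matrix.conjTranspose_smul, hX]
    simp
  obtain ⟨U, hU, θ, hθ⟩ := hH.exists_conjDiagonal
  refine ⟨U, hU, θ, ?_⟩
  have h : X = Complex.I • (-Complex.I • X) := by simp [smul_smul]
  rw [h, hθ, conjDiagonal_smul]
  congr 1
  funext i
  simp [mul_comm]

/-- Only the endpoint `-π` falls outside the principal range; this jump of `2π` is the sole source
of non-uniqueness of logarithms. -/
theorem arg_exp_mul_I_of_mem {θ : ℝ} (h1 : -Real.pi ≤ θ) (h2 : θ ≤ Real.pi) :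
    Complex.arg (Complex.exp (θ * Complex.I)) =
      θ + if θ = -Real.pi then 2 * Real.pi else 0 := by
  split_ifs with h
  · rw [h, Complex.ofReal_neg, neg_mul, Complex.exp_neg_pi_mul_I, Complex.arg_neg_one]
    ring
  · rw [Complex.arg_exp_mul_I, add_zero]
    exact (toIocMod_eq_self _).2 ⟨lt_of_le_of_ne h1 (Ne.symm h), by linarith⟩

namespace PrincipalLog

variable {Q : Matrix (Fin n) (Fin n) ℂ} (D : PrincipalLog Q)

/-- The modification of the principal logarithm by a projector of the eigenspace for `-1`. -/
noncomputable def twist (P : Matrix (Fin (negOneMult Q)) (Fin (negOneMult Q)) ℂ) :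
    Matrix (Fin n) (Fin n) ℂ :=
  D.L - (2 * Real.pi * Complex.I) • (D.J * P * D.J.conjTranspose)

/-- The inverse of `twist`. -/
noncomputable def untwist (X : Matrix (Fin n) (Fin n) ℂ) :
    Matrix (Fin (negOneMult Q)) (Fin (negOneMult Q)) ℂ :=
  (2 * Real.pi * Complex.I)⁻¹ • (D.J.conjTranspose * (D.L - X) * D.J)

theorem conjTranspose_J_mul_mul_J (P : Matrix (Fin (negOneMult Q)) (Fin (negOneMult Q)) ℂ) :
    D.J.conjTranspose * (D.J * P * D.J.conjTranspose) * D.J = P := by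
  rw [Matrix.mul_assoc, Matrix.mul_assoc (D.J * P), D.conjTranspose_J_mul_J, Matrix.mul_one,
    ← Matrix.mul_assoc, D.conjTranspose_J_mul_J, Matrix.one_mul]

theorem untwist_twist (P : Matrix (Fin (negOneMult Q)) (Fin (negOneMult Q)) ℂ) :
    D.untwist (D.twist P) = P := by
  rw [untwist, twist, sub_sub_cancel, Matrix.mul_smul, Matrix.smul_mul,
    D.conjTranspose_J_mul_mul_J, smul_smul, inv_mul_cancel₀ Complex.two_pi_I_ne_zero, one_smul]

theorem trace_mul_mul (P : Matrix (Fin (negOneMult Q)) (Fin (negOneMult Q)) ℂ) :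
    (D.J * P * D.J.conjTranspose).trace = P.trace := by
  rw [Matrix.trace_mul_comm, ← Matrix.mul_assoc, D.conjTranspose_J_mul_J, Matrix.one_mul]

theorem isStarProjection_mul_mul {P : Matrix (Fin (negOneMult Q)) (Fin (negOneMult Q)) ℂ}
    (hP : IsStarProjection P) : IsStarProjection (D.J * P * D.J.conjTranspose) := by
  have h1 : P.conjTranspose = P := hP.isSelfAdjoint
  have h2 : P * P = P := hP.isIdempotentElem
  constructor
  · calc D.J * P * D.J.conjTranspose * (D.J * P * D.J.conjTranspose)
        = D.J * P * (D.J.conjTranspose * D.J) * P * D.J.conjTranspose := by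
          simp only [Matrix.mul_assoc]
      _ = D.J * P * D.J.conjTranspose := by
          rw [D.conjTranspose_J_mul_J, Matrix.mul_one, Matrix.mul_assoc D.J, h2]
  · rw [IsSelfAdjoint, Matrix.star_eq_conjTranspose]
    simp [h1, Matrix.mul_assoc]

/-- The adjoint of `L_mul_J`; the signs from skewness and from conjugating `πi` cancel. It makes `L`
commute with every `J P J*`. -/
theorem conjTranspose_J_mul_L :
    D.J.conjTranspose * D.L = (Real.pi * Complex.I) • D.J.conjTranspose := by
  have h := congrArg Matrix.conjTranspose D.L_mul_J
  rw [Matrix.conjTranspose_mul, D.conjTranspose_L, Matrix.mul_neg, Matrix.conjTranspose_smul] at h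
  rw [← neg_inj, h]
  simp

theorem L_mul_mul (P : Matrix (Fin (negOneMult Q)) (Fin (negOneMult Q)) ℂ) :
    D.L * (D.J * P * D.J.conjTranspose) =
      (Real.pi * Complex.I) • (D.J * P * D.J.conjTranspose) := by
  rw [Matrix.mul_assoc D.J, ← Matrix.mul_assoc, D.L_mul_J, Matrix.smul_mul]

theorem mul_mul_L (P : Matrix (Fin (negOneMult Q)) (Fin (negOneMult Q)) ℂ) :
    D.J * P * D.J.conjTranspose * D.L =
      (Real.pi * Complex.I) • (D.J * P * D.J.conjTranspose) := by
  rw [Matrix.mul_assoc, D.conjTranspose_J_mul_L, Matrix.mul_smul]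

theorem twist_mem_su {P : Matrix (Fin (negOneMult Q)) (Fin (negOneMult Q)) ℂ}
    (hP : IsStarProjection P) (ht : P.trace = (argSum Q : ℂ)) : D.twist P ∈ su n := by
  have h : (D.J * P * D.J.conjTranspose).conjTranspose = D.J * P * D.J.conjTranspose :=
    (D.isStarProjection_mul_mul hP).isSelfAdjoint
  constructor
  · rw [twist, Matrix.conjTranspose_sub, Matrix.conjTranspose_smul, h, D.conjTranspose_L]
    simp only [star_mul', Complex.star_def, Complex.conj_I, Complex.conj_ofReal, map_ofNat]
    module
  · rw [twist, Matrix.trace_sub, Matrix.trace_smul, D.trace_mul_mul, D.trace_L, ht, smul_eq_mul,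
      sub_self]

/-- The two summands commute and the exponential of `-2πi` times a projector is `1`. -/
theorem exp_twist {P : Matrix (Fin (negOneMult Q)) (Fin (negOneMult Q)) ℂ}
    (hP : IsStarProjection P) : NormedSpace.exp (D.twist P) = Q := by
  have hc : Commute D.L (-(2 * Real.pi * Complex.I) • (D.J * P * D.J.conjTranspose)) := by
    refine Commute.smul_right ?_ _
    rw [Commute, SemiconjBy, D.L_mul_mul, D.mul_mul_L]
  rw [twist, sub_eq_add_neg, ← neg_smul, Matrix.exp_add_of_commute _ _ hc,
    exp_smul_of_isStarProjection (D.isStarProjection_mul_mul hP), mul_one, D.exp_L]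
  rw [Complex.exp_neg, Complex.exp_two_pi_mul_I, inv_one]

/-- With `R = J P J*`, an eigenvector killed by `R` is one of `L`. Otherwise `R (L - 2πi R) = -πi R`
forces `z = -πi`. -/
theorem im_mem_of_twist_mulVec {P : Matrix (Fin (negOneMult Q)) (Fin (negOneMult Q)) ℂ}
    (hP : IsStarProjection P) {v : Fin n → ℂ} {z : ℂ} (hv : v ≠ 0)
    (h : (D.twist P).mulVec v = z • v) : -Real.pi ≤ z.im ∧ z.im ≤ Real.pi := by
  set R := D.J * P * D.J.conjTranspose with hR
  have hRR : R * R = R := (D.isStarProjection_mul_mul hP).isIdempotentElem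
  by_cases h0 : R.mulVec v = 0
  · refine D.im_mem hv ?_
    rw [← h, twist, Matrix.sub_mulVec, Matrix.smul_mulVec, h0, smul_zero, sub_zero]
  · have h1 : R * D.twist P = (-(Real.pi * Complex.I)) • R := by
      rw [twist, mul_sub, mul_smul_comm, ← hR, hRR, D.mul_mul_L]
      module
    have h2 := congrArg R.mulVec h
    rw [Matrix.mulVec_mulVec, h1, Matrix.smul_mulVec, Matrix.mulVec_smul] at h2
    have h3 : -(Real.pi * Complex.I) = z := smul_left_injective ℂ h0 h2
    rw [← h3]
    simp [Real.pi_pos.le]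

/-- Every generalized principal logarithm is a twist of the principal logarithm. -/
theorem exists_twist_eq {X : Matrix (Fin n) (Fin n) ℂ} (hX : X ∈ su n)
    (hexp : NormedSpace.exp X = Q)
    (him : ∀ z : ℂ, Module.End.HasEigenvalue (Matrix.toLin' X) z →
      -Real.pi ≤ z.im ∧ z.im ≤ Real.pi) :
    ∃ P, IsStarProjection P ∧ P.trace = (argSum Q : ℂ) ∧ X = D.twist P := by
  obtain ⟨V, hV, θ, hθ⟩ := exists_conjDiagonal_of_skew hX.1
  have hVV := (Matrix.mem_unitaryGroup_iff').1 hV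
  have hXV : X * V = V * Matrix.diagonal fun i => θ i * Complex.I := by
    rw [hθ, conjDiagonal_mul_self hV]
  have hθm : ∀ i, -Real.pi ≤ θ i ∧ θ i ≤ Real.pi := by
    intro i
    have h1 : Module.End.HasEigenvalue (Matrix.toLin' X) (θ i * Complex.I) := by
      refine Module.End.hasEigenvalue_of_hasEigenvector (x := V.mulVec (Pi.single i 1))
        ⟨Module.End.mem_eigenspace_iff.2 ?_, fun h => ?_⟩
      · rw [Matrix.toLin'_apply, Matrix.mulVec_mulVec, hXV, ← Matrix.mulVec_mulVec,
          Matrix.diagonal_mulVec_single, mul_one, ← Matrix.mulVec_smul, ← Pi.single_smul,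
          smul_eq_mul, mul_one]
      · have h2 := congrArg (star V).mulVec h
        rw [Matrix.mulVec_mulVec, hVV, Matrix.one_mulVec, Matrix.mulVec_zero] at h2
        simpa using congrFun h2 i
    simpa using him _ h1
  have hQV : Q * V = V * Matrix.diagonal fun i => Complex.exp (θ i * Complex.I) := by
    rw [← hexp, hθ, exp_conjDiagonal hV, conjDiagonal_mul_self hV]
  -- The indicator of the eigenvalue `-πi`; `R` below is the corresponding spectral projector of
  -- `X`.
  let δ : Fin n → ℂ := fun i => if θ i = -Real.pi then 1 else 0
  have hδδ : δ * δ = δ := by funext i; simp [δ]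
  have hδs : star δ = δ := by funext i; simp [δ, apply_ite]
  set R := conjDiagonal V δ with hR
  have hRs : R.conjTranspose = R := by
    rw [← Matrix.star_eq_conjTranspose, hR, star_conjDiagonal, hδs]
  have hRR : R * R = R := by rw [hR, conjDiagonal_mul hV, hδδ]
  have hL : D.L = X + (2 * Real.pi * Complex.I) • R := by
    rw [hθ, hR, conjDiagonal_smul, conjDiagonal_add]
    refine eq_conjDiagonal hV ?_
    rw [D.L_mul_of_eigenbasis hQV]
    congr 2
    funext i
    rw [arg_exp_mul_I_of_mem (hθm i).1 (hθm i).2]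
    simp only [Pi.add_apply, Pi.smul_apply, smul_eq_mul, δ]
    split_ifs <;> push_cast <;> ring
  -- Since `exp (-πi) = -1`, the range of `R` lies in the `-1`-eigenspace of `Q`, onto which `J J*`
  -- projects.
  have hJR : D.J * D.J.conjTranspose * R = R := by
    rw [hR, conjDiagonal, ← Matrix.mul_assoc, ← Matrix.mul_assoc, D.J_mul_of_eigenbasis hQV,
      Matrix.mul_assoc V, Matrix.diagonal_mul_diagonal]
    congr 3
    funext i
    by_cases h : θ i = -Real.pi
    · simp [δ, h, Complex.exp_neg_pi_mul_I]
    · simp [δ, h]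
  have hRJ : R * (D.J * D.J.conjTranspose) = R := by
    have h := congrArg Matrix.conjTranspose hJR
    simpa [hRs] using h
  have hJPJ : D.J * (D.J.conjTranspose * R * D.J) * D.J.conjTranspose = R := by
    calc _ = (D.J * D.J.conjTranspose * R) * (D.J * D.J.conjTranspose) := by
          simp only [Matrix.mul_assoc]
      _ = R := by rw [hJR, hRJ]
  -- The compression of `R` to `ℂ^s`; nothing is lost, by `hJPJ`.
  refine ⟨D.J.conjTranspose * R * D.J, ⟨?_, ?_⟩, ?_, ?_⟩
  · calc D.J.conjTranspose * R * D.J * (D.J.conjTranspose * R * D.J)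
        = D.J.conjTranspose * (R * (D.J * D.J.conjTranspose) * R) * D.J := by
          simp only [Matrix.mul_assoc]
      _ = _ := by rw [hRJ, hRR]
  · rw [IsSelfAdjoint, Matrix.star_eq_conjTranspose]
    simp [hRs, Matrix.mul_assoc]
  · rw [← D.trace_mul_mul, hJPJ]
    have h := congrArg Matrix.trace hL
    rw [D.trace_L, Matrix.trace_add, hX.2, zero_add, Matrix.trace_smul, smul_eq_mul] at h
    exact (mul_left_cancel₀ Complex.two_pi_I_ne_zero h).symm
  · rw [twist, hJPJ, hL, add_sub_cancel_right]

theorem mem_plog_iff {X : su n} : X ∈ plog (su n) Q ↔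
    ∃ P, IsStarProjection P ∧ P.trace = (argSum Q : ℂ) ∧ (X : Matrix (Fin n) (Fin n) ℂ) =
      D.twist P := by
  constructor
  · rintro ⟨h1, h2⟩
    exact D.exists_twist_eq X.2 h1 h2
  · rintro ⟨P, hP, -, hXP⟩
    refine ⟨by rw [hXP, D.exp_twist hP], fun z hz => ?_⟩
    obtain ⟨v, hv⟩ := hz.exists_hasEigenvector
    refine D.im_mem_of_twist_mulVec hP hv.2 ?_
    rw [← hXP]
    exact hv.apply_eq_smul

end PrincipalLog

end PrincipalLog

/-! ### Projectors of extreme rank, integrality, and the classification -/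

section Main

variable {n s : ℕ}

theorem isStarProjection_diagonal_indicator (p : Fin s → Prop) [DecidablePred p] :
    IsStarProjection (Matrix.diagonal fun i => if p i then (1 : ℂ) else 0) := by
  constructor
  · rw [IsIdempotentElem, Matrix.diagonal_mul_diagonal]
    simp
  · rw [IsSelfAdjoint, Matrix.star_eq_conjTranspose, Matrix.diagonal_conjTranspose]
    congr 1
    funext i
    simp [apply_ite]

theorem trace_diagonal_indicator {k : ℕ} (hk : k ≤ s) :
    (Matrix.diagonal fun i : Fin s => if i.val < k then (1 : ℂ) else 0).trace = k := by
  rw [Matrix.trace_diagonal, Finset.sum_boole, Fin.card_filter_val_lt, min_eq_right hk]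

/-- There is exactly one projector of a given rank precisely in the extreme cases. -/
theorem subsingleton_isStarProjection_iff {k : ℕ} (hk : k ≤ s) :
    {P : Matrix (Fin s) (Fin s) ℂ | IsStarProjection P ∧ P.trace = k}.Subsingleton ↔
      k = 0 ∨ k = s := by
  constructor
  · intro h
    by_contra! hne
    have hs : 0 < s := by omega
    have h1 := trace_diagonal_indicator (s := s) hk
    -- The projectors onto the first `k` and the last `k` coordinates differ at index `0` when `0 <
    -- k < s`.
    have h2 : (Matrix.diagonal fun i : Fin s => if (Fin.rev i).val < k then (1 : ℂ) else 0).trace =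
        k := by
      rw [← h1, Matrix.trace_diagonal, Matrix.trace_diagonal]
      exact Equiv.sum_comp Fin.revPerm fun i : Fin s => if i.val < k then (1 : ℂ) else 0
    have h3 := h ⟨isStarProjection_diagonal_indicator _, h1⟩
      ⟨isStarProjection_diagonal_indicator _, h2⟩
    have h4 := congrFun (Matrix.diagonal_injective h3) ⟨0, hs⟩
    simp only [Fin.val_rev] at h4
    rw [if_pos (by omega), if_neg (by omega)] at h4
    exact one_ne_zero h4
  · intro h P hP P' hP'
    have hr : ∀ {P : Matrix (Fin s) (Fin s) ℂ}, IsStarProjection P → P.trace = k →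
        Module.finrank ℂ (LinearMap.range (Matrix.toLin' P)) = k := fun hP ht => by
      rw [hP.trace_eq_finrank] at ht
      exact_mod_cast ht
    refine hP.1.eq_of_range_eq hP'.1 ?_
    have h1 := hr hP.1 hP.2
    have h2 := hr hP'.1 hP'.2
    rcases h with rfl | rfl
    · rw [Submodule.finrank_eq_zero] at h1 h2
      rw [h1, h2]
    · rw [Submodule.eq_top_of_finrank_eq (h1.trans (by simp)),
        Submodule.eq_top_of_finrank_eq (h2.trans (by simp))]

/-- The determinant is `∏ exp (i arg μ) = exp (2πi ζ)`, and it equals `1`. -/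
theorem exists_int_eq_argSum {Q : Matrix (Fin n) (Fin n) ℂ}
    (hQ : Q ∈ Matrix.specialUnitaryGroup (Fin n) ℂ) : ∃ m : ℤ, argSum Q = m := by
  obtain ⟨hQu, hdet⟩ := Matrix.mem_specialUnitaryGroup_iff.1 hQ
  obtain ⟨U, hU, d, rfl⟩ := exists_conjDiagonal_of_mem_unitaryGroup hQu
  rw [det_conjDiagonal hU] at hdet
  have h1 : Complex.exp (∑ i, Complex.arg (d i) * Complex.I) = 1 := by
    rw [Complex.exp_sum, ← hdet]
    refine Finset.prod_congr rfl fun i _ => ?_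
    have h := Complex.norm_mul_exp_arg_mul_I (d i)
    rw [norm_eq_one_of_conjDiagonal_mem hU hQu] at h
    simpa using h
  have h2 := congrArg (fun x : ℝ => (x : ℂ)) (argSum_conjDiagonal hU d)
  simp only [Complex.ofReal_mul, Complex.ofReal_sum, Complex.ofReal_ofNat] at h2
  rw [← Finset.sum_mul, ← h2, Complex.exp_eq_one_iff] at h1
  obtain ⟨m, hm⟩ := h1
  refine ⟨m, ?_⟩
  have h3 : (argSum (conjDiagonal U d) : ℂ) = m :=
    mul_left_cancel₀ Complex.two_pi_I_ne_zero (by linear_combination hm)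
  exact_mod_cast h3

namespace PrincipalLog

variable {Q : Matrix (Fin n) (Fin n) ℂ} (D : PrincipalLog Q)

theorem contDiff_twist : ContDiff ℝ ∞ D.twist :=
  contDiff_const.sub ((contDiff_matrix_mul.comp ((contDiff_matrix_mul.comp
    (contDiff_const.prodMk contDiff_id)).prodMk contDiff_const)).const_smul _)

theorem contDiff_untwist : ContDiff ℝ ∞ D.untwist :=
  (contDiff_matrix_mul.comp ((contDiff_matrix_mul.comp (contDiff_const.prodMk
    (contDiff_const.sub contDiff_id))).prodMk contDiff_const)).const_smul _

/-- The generalized principal logarithms are smoothly parametrised by projectors. -/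
theorem exists_contDiff_image_eq_plog :
    ∃ A : Matrix (Fin (negOneMult Q)) (Fin (negOneMult Q)) ℂ → su n, ContDiff ℝ ∞ A ∧
      (∀ P, IsStarProjection P → P.trace = (argSum Q : ℂ) →
        (A P : Matrix (Fin n) (Fin n) ℂ) = D.twist P) ∧
      A '' {P | IsStarProjection P ∧ P.trace = (argSum Q : ℂ)} = plog (su n) Q := by
  -- Here `π` is a linear retraction onto `su n`: it extends the parametrisation smoothly to all
  -- matrices `P`, although `twist P` need not lie in `su n`.
  obtain ⟨π, hπ⟩ := (su n).subtype.exists_leftInverse_of_injective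
    (LinearMap.ker_eq_bot.2 (su n).injective_subtype)
  have hA : ∀ P, IsStarProjection P → P.trace = (argSum Q : ℂ) →
      (π (D.twist P) : Matrix (Fin n) (Fin n) ℂ) = D.twist P := fun P hP ht =>
    congrArg Subtype.val (LinearMap.congr_fun hπ ⟨D.twist P, D.twist_mem_su hP ht⟩)
  refine ⟨fun P => π (D.twist P),
    (LinearMap.toContinuousLinearMap π).contDiff.comp D.contDiff_twist, hA, ?_⟩
  ext X
  rw [D.mem_plog_iff]
  constructor
  · rintro ⟨P, ⟨hP, ht⟩, rfl⟩
    exact ⟨P, hP, ht, hA P hP ht⟩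
  · rintro ⟨P, hP, ht, hX⟩
    exact ⟨P, ⟨hP, ht⟩, Subtype.ext ((hA P hP ht).trans hX.symm)⟩

end PrincipalLog

end Main

theorem proposition3p3 (n : ℕ) (hn : 2 ≤ n) (Q : Matrix (Fin n) (Fin n) ℂ)
    (hQ : Q ∈ Matrix.specialUnitaryGroup (Fin n) ℂ) :
    ((argSum Q < 0 ∨ (negOneMult Q : ℝ) < argSum Q) → plog (su n) Q = ∅) ∧
    (0 ≤ argSum Q → argSum Q ≤ (negOneMult Q : ℝ) →
      IsCompact (plog (su n) Q) ∧
      (∃ k : ℕ, (k : ℝ) = argSum Q ∧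
        IsSubmanifoldDiffeomorphicTo (plog (su n) Q) 𝓘(ℝ, Gr.Model k (negOneMult Q))
          (Gr k (negOneMult Q))) ∧
      ((∃ X : su n, plog (su n) Q = {X}) ↔
        (argSum Q = 0 ∨ argSum Q = (negOneMult Q : ℝ)))) := by
  obtain ⟨D⟩ := nonempty_principalLog (Matrix.mem_specialUnitaryGroup_iff.1 hQ).1
  refine ⟨fun h => Set.eq_empty_iff_forall_notMem.2 fun X hX => ?_, fun h0 h1 => ?_⟩
  · obtain ⟨P, hP, ht, -⟩ := D.mem_plog_iff.1 hX
    rw [hP.trace_eq_finrank] at ht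
    have ht' : (Module.finrank ℂ (LinearMap.range (Matrix.toLin' P)) : ℝ) = argSum Q := by
      exact_mod_cast ht
    have hle : Module.finrank ℂ (LinearMap.range (Matrix.toLin' P)) ≤ negOneMult Q := by
      simpa using Submodule.finrank_le (LinearMap.range (Matrix.toLin' P))
    rcases h with h | h
    · rw [← ht'] at h
      exact absurd h (not_lt.2 (Nat.cast_nonneg _))
    · rw [← ht', Nat.cast_lt] at h
      omega
  · obtain ⟨m, hm⟩ := exists_int_eq_argSum hQ
    obtain ⟨k, rfl⟩ : ∃ k : ℕ, m = k := Int.eq_ofNat_of_zero_le (by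
      rw [hm] at h0; exact_mod_cast h0)
    have hk : argSum Q = k := by rw [hm]; simp
    have hks : k ≤ negOneMult Q := by rw [hk] at h1; exact_mod_cast h1
    obtain ⟨A, hA, hAt, himg⟩ := D.exists_contDiff_image_eq_plog
    simp only [hk, Complex.ofReal_natCast] at hAt himg
    refine ⟨?_, ⟨k, hk.symm, ?_⟩, ?_⟩
    · rw [← himg]
      exact (isCompact_setOf_isStarProjection (k : ℂ)).image hA.continuous
    · have hr : plog (su n) Q = Set.range fun W : Gr k (negOneMult Q) => A (Gr.proj W) := by
        rw [← himg]
        ext X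
        constructor
        · rintro ⟨P, ⟨hP, ht⟩, rfl⟩
          obtain ⟨W, rfl⟩ := Gr.exists_proj_eq hP ht
          exact ⟨W, rfl⟩
        · rintro ⟨W, rfl⟩
          exact ⟨_, ⟨Gr.isStarProjection_proj W, Gr.trace_proj W⟩, rfl⟩
      rw [hr]
      -- The restriction of `untwist` to `su n` is a global smooth left inverse on the relevant
      -- projectors.
      refine Gr.isSubmanifoldDiffeomorphicTo_range_proj (B := fun X : su n => D.untwist X) hA
        (D.contDiff_untwist.comp (su n).subtypeL.contDiff) fun W => ?_
      rw [hAt _ (Gr.isStarProjection_proj W) (Gr.trace_proj W), D.untwist_twist]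
    · have hinj : Set.InjOn A {P | IsStarProjection P ∧ P.trace = (k : ℂ)} := by
        intro P hP P' hP' h
        have h2 := congrArg (fun X : su n => D.untwist X) h
        simpa only [hAt P hP.1 hP.2, hAt P' hP'.1 hP'.2, D.untwist_twist] using h2
      have hne : (plog (su n) Q).Nonempty := by
        rw [← himg]
        exact ⟨_, _, ⟨isStarProjection_diagonal_indicator _, trace_diagonal_indicator hks⟩, rfl⟩
      have hiff : (∃ X, plog (su n) Q = {X}) ↔ (plog (su n) Q).Subsingleton :=
        Set.exists_eq_singleton_iff_nonempty_subsingleton.trans (and_iff_right hne)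
      have hsub : (A '' {P | IsStarProjection P ∧ P.trace = (k : ℂ)}).Subsingleton ↔
          {P : Matrix (Fin (negOneMult Q)) (Fin (negOneMult Q)) ℂ |
            IsStarProjection P ∧ P.trace = (k : ℂ)}.Subsingleton :=
        ⟨fun h P hP P' hP' => hinj hP hP' (h ⟨P, hP, rfl⟩ ⟨P', hP', rfl⟩), fun h => h.image A⟩
      rw [hiff, ← himg, hsub, subsingleton_isStarProjection_iff hks, hk]
      norm_cast
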